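/- Let $n\le 32$ and let $L\subset\mathbb R^n$ be an even unimodular lattice, i.e. $L=L^*=\{y : x\cdot y\in\mathbb Z\ \forall x\in L\}$ and $x\cdot x\in 2\mathbb Z$ for all $x\in L$. For $s>0$ put $L(s)=\{x\in L: x\cdot x=s\}$, and let $a_m=|L(2m)|$. If $n=32$, assume in addition that every nonempty shell $L(r^2)$, $r>0$, is a spherical $2$-design (for every real polynomial of degree at most $2$, its average over $L(r^2)$ equals its average over the sphere of radius $r$ with respect to the rotation-invariant probability measure). Let $\sum_{m\ge1} b_m q^m$ be the cusp form of weight $n/2+4$ for $\mathrm{SL}_2(\mathbb Z)$ normalized by $b_1=1$ (for $n=8$, where the only cusp form of weight $8$ is $0$, take all $b_m=0$). For $\alpha>0$ let $f_\alpha(r)=e^{-\alpha r}$ and, for a lattice $M$, let $\mathcal E(f_\alpha,M)=\sum_{x\in M\setminus\{0\}} f_\alpha(\|x\|^2)$. Let $\mathcal T_0$ be the space of real symmetric $n\times n$ matrices of trace zero, with the inner product $\langle A,B\rangle=\operatorname{Tr}(AB)$; it is the tangent space at $L$ of the manifold of lattices of point density $1$, with exponential chart $H\mapsto \exp(H/2)L$.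 The Hessian of $\mathcal E(f_\alpha,\cdot)$ at $L$ is the quadratic form on $\mathcal T_0$ $$\nabla^2\mathcal E(f_\alpha,L)[H]=\tfrac12\,\frac{d^2}{dt^2}\Big|_{t=0}\mathcal E\big(f_\alpha,\exp(tH/2)L\big),$$ that is, the second-order term of the Taylor expansion of the energy along the geodesic $t\mapsto\exp(tH/2)L$; its eigenvalues are those of the associated symmetric bilinear form with respect to $\langle\cdot,\cdot\rangle$. Write $H[x]=x^{\mathsf T}Hx$ and $Q[H]=\sum_{x\in L(2)}H[x]^2$ for symmetric $H$; a number $\lambda$ is an eigenvalue of $Q$ with eigenvector $H\ne0$ if $\sum_{x\in L(2)}H[x]\,G[x]=\lambda\operatorname{Tr}(HG)$ for all symmetric matrices $G$. Then the energy $\mathcal E(f_\alpha,\exp(H/2)L)$ converges for every $H\in\mathcal T_0$, the function $t\mapsto\mathcal E(f_\alpha,\exp(tH/2)L)$ is $C^2$ near $t=0$, the two series below converge absolutely, and a real number $\mu$ is an eigenvalue of the Hessian $\nabla^2\mathcal E(f_\alpha,L)$ on $\mathcal T_0$ if and only if $$\mu=\frac1{n(n+2)}\sum_{m=1}^\infty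 b_m\frac{\alpha^2}{2}\big(\lambda n(n+2)-8a_1\big)e^{-2\alpha m}+\frac1{n(n+2)}\sum_{m=1}^\infty a_m\,2\alpha m\big(2\alpha m-(n/2+1)\big)e^{-2\alpha m}$$ for some eigenvalue $\lambda$ of $Q$ that has an eigenvector in $\mathcal T_0$. -/

import Mathlib

open scoped MatrixGroups Matrix

noncomputable section

namespace GaussianCore

/-- Euclidean space `ℝⁿ` with its standard inner product. -/
abbrev E (n : ℕ) : Type := EuclideanSpace ℝ (Fin n)

/-- The value `H[x] = xᵀ H x`. -/
def quadVal {n : ℕ} (H : Matrix (Fin n) (Fin n) ℝ) (x : E n) : ℝ :=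
  x.ofLp ⬝ᵥ (H *ᵥ x.ofLp)

/-- The shell `L(s) = {x ∈ L : x · x = s}`. -/
def shell {n : ℕ} (L : Submodule ℤ (E n)) (s : ℝ) : Set (E n) :=
  {x | x ∈ L ∧ inner ℝ x x = s}

/-- Shells of a lattice are finite, so that sums over them and their cardinality are genuine. -/
theorem shell_finite {n : ℕ} (L : Submodule ℤ (E n)) [DiscreteTopology L] (s : ℝ) :
    (shell L s).Finite := by
  have h : (Metric.closedBall (0 : E n) √s ∩ (L.toAddSubgroup : Set (E n))).Finite := by
    have : DiscreteTopology L.toAddSubgroup := ‹DiscreteTopology L›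
    exact Metric.finite_isBounded_inter_isClosed DiscreteTopology.isDiscrete
      Metric.isBounded_closedBall inferInstance
  refine h.subset ?_
  rintro x ⟨hx, hs⟩
  refine ⟨?_, hx⟩
  rw [mem_closedBall_zero_iff, ← hs, real_inner_self_eq_norm_sq, Real.sqrt_sq (norm_nonneg x)]

/-- The theta coefficient `a_m = |L(2m)|`. -/
def thetaCoeff {n : ℕ} (L : Submodule ℤ (E n)) (m : ℕ) : ℕ :=
  (shell L (2 * (m : ℝ))).ncard

/-- The dual `L* = {y ∈ ℝⁿ : x · y ∈ ℤ for all x ∈ L}`. -/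
def dualSet {n : ℕ} (L : Submodule ℤ (E n)) : Set (E n) :=
  {y | ∀ x ∈ L, ∃ k : ℤ, inner ℝ x y = (k : ℝ)}

/-- `L` coincides with its dual and all its squared norms are even integers. -/
structure IsEvenUnimodular {n : ℕ} (L : Submodule ℤ (E n)) : Prop where
  unimodular : (L : Set (E n)) = dualSet L
  even : ∀ x ∈ L, ∃ k : ℤ, inner ℝ x x = 2 * (k : ℝ)

/-- A finite set `X` on the sphere of radius `r` is a spherical `t`-design if, for every polynomial
of degree at most `t`, its mean over the sphere (with respect to the rotationally invariant
probability measure) equals its mean over `X`. -/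
def IsSphericalDesign {n : ℕ} (t : ℕ) (r : ℝ) (X : Set (E n)) : Prop :=
  X.Finite ∧ X ⊆ Metric.sphere 0 r ∧
    ∀ p : MvPolynomial (Fin n) ℝ, p.totalDegree ≤ t →
      (⨍ u : Metric.sphere (0 : E n) 1,
          MvPolynomial.eval (r • (u : E n)).ofLp p ∂(MeasureTheory.volume.toSphere)) =
        (∑ᶠ x ∈ X, MvPolynomial.eval x.ofLp p) / (X.ncard : ℝ)

/-- All (nonempty) shells of `L`, except the origin, are spherical `t`-designs. -/
def AllShellsDesigns {n : ℕ} (t : ℕ) (L : Submodule ℤ (E n)) : Prop :=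
  ∀ r : ℝ, 0 < r → (shell L (r ^ 2)).Nonempty → IsSphericalDesign t r (shell L (r ^ 2))

/-- The Gaussian potential `f_α(r) = exp (-α r)`. -/
def gaussian (α : ℝ) (r : ℝ) : ℝ := Real.exp (-α * r)

/-- The `f`-potential energy of `L`, the sum of `f (‖x‖²)` over the nonzero vectors of `L`. -/
def energy {n : ℕ} (f : ℝ → ℝ) (L : Submodule ℤ (E n)) : ℝ :=
  ∑' x : {x : E n // x ∈ L ∧ x ≠ 0}, f (‖(x : E n)‖ ^ 2)

/-- Symmetric matrices of trace zero: the tangent space, at the identity, of the manifold of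
positive definite matrices of determinant one. -/
def IsTangent {n : ℕ} (H : Matrix (Fin n) (Fin n) ℝ) : Prop :=
  H.IsSymm ∧ H.trace = 0

/-- The lattice `exp (H/2) L`. Its vectors `y = exp (H/2) x` have `‖y‖² = xᵀ (exp H) x` when `H` is
symmetric. For tangent `H` it has the same density as `L`, and `H ↦ deform L H` is the exponential
chart, centred at `L`, of the manifold of lattices with that density. -/
def deform {n : ℕ} (L : Submodule ℤ (E n)) (H : Matrix (Fin n) (Fin n) ℝ) : Submodule ℤ (E n) :=
  L.map ((Matrix.toEuclideanLin (NormedSpace.exp ((1 / 2 : ℝ) • H))).restrictScalars ℤ)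

/-- The Hessian at `L` of `M ↦ energy (gaussian α) M`, as a function of the tangent direction `H`:
the coefficient of `t ^ 2` in the Taylor expansion of the energy along the geodesic
`t ↦ deform L (t • H)`, that is, half of its second derivative at `0`. -/
def hessian {n : ℕ} (α : ℝ) (L : Submodule ℤ (E n)) (H : Matrix (Fin n) (Fin n) ℝ) : ℝ :=
  iteratedDeriv 2 (fun t : ℝ => energy (gaussian α) (deform L (t • H))) 0 / 2

/-- The symmetric bilinear form whose quadratic form is `hessian α L`. -/
def hessianBilin {n : ℕ} (α : ℝ) (L : Submodule ℤ (E n)) (G H : Matrix (Fin n) (Fin n) ℝ) : ℝ :=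
  (hessian α L (G + H) - hessian α L G - hessian α L H) / 2

/-- `μ` is an eigenvalue of the Hessian on the tangent space, with respect to the inner product
`⟨A, B⟩ = Tr (A B)`. -/
def IsHessianEigenvalue {n : ℕ} (α : ℝ) (L : Submodule ℤ (E n)) (μ : ℝ) : Prop :=
  ∃ H : Matrix (Fin n) (Fin n) ℝ, IsTangent H ∧ H ≠ 0 ∧
    ∀ G : Matrix (Fin n) (Fin n) ℝ, IsTangent G → hessianBilin α L H G = μ * (H * G).trace

/-- The bilinear form `b_Q(G, H) = ∑_{x ∈ L(2)} G[x] H[x]`, whose quadratic form is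
`Q[H] = ∑_{x ∈ L(2)} H[x]²`. -/
def rootBilin {n : ℕ} (L : Submodule ℤ (E n)) (G H : Matrix (Fin n) (Fin n) ℝ) : ℝ :=
  ∑ᶠ x ∈ shell L 2, quadVal G x * quadVal H x

/-- `lam` is an eigenvalue of `Q` (on the space of symmetric matrices with `⟨A, B⟩ = Tr (A B)`)
that has an eigenvector in the tangent space. -/
def IsRootEigenvalue {n : ℕ} (L : Submodule ℤ (E n)) (lam : ℝ) : Prop :=
  ∃ H : Matrix (Fin n) (Fin n) ℝ, IsTangent H ∧ H ≠ 0 ∧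
    ∀ G : Matrix (Fin n) (Fin n) ℝ, G.IsSymm → rootBilin L H G = lam * (H * G).trace

/-- The `m`-th coefficient of the `q`-expansion, `q = exp (2πiτ)`, of a cusp form for the full
modular group. -/
def cuspCoeff {k : ℤ} (f : CuspForm 𝒮ℒ k) (m : ℕ) : ℂ :=
  (UpperHalfPlane.qExpansion 1 f).coeff m

/-- The `m`-th term of the first series, in the cusp form coefficients `b`. -/
def cuspTerm {n : ℕ} (L : Submodule ℤ (E n)) (b : ℕ → ℂ) (α lam : ℝ) (m : ℕ) : ℂ :=
  b m * (α ^ 2 / 2) * (lam * n * (n + 2) - 8 * thetaCoeff L 1) * Complex.exp (-2 * α * m)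

/-- The `m`-th term of the second series, in the theta coefficients. -/
def thetaTerm {n : ℕ} (L : Submodule ℤ (E n)) (α : ℝ) (m : ℕ) : ℝ :=
  thetaCoeff L m * (2 * α * m) * (2 * α * m - (n / 2 + 1)) * Real.exp (-2 * α * m)

end GaussianCore

end

/-! Diagonalise a trace-zero symmetric $H$ with eigenbasis $e$ and eigenvalues $d_i$. The energy of
$\exp(tH/2)L$ is then a theta sum with exponents $\alpha\sum_i e^{td_i}\langle e_i,x\rangle^2$,
minus the term of the origin. Two termwise differentiations give $\nabla^2\mathcal
E[H]=\frac{\alpha^2}{2}\sum_x H[x]^2e^{-\alpha\|x\|^2}-\frac{\alpha}{2}\sum_x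
H^2[x]e^{-\alpha\|x\|^2}$.

The same deformation produces the modularity of these weighted theta series. Poisson summation and
$L=L^*$ give an inversion formula for the deformed theta sum which exchanges $t$ and $-t$
(`deformSum_inversion`). Its first $t$-derivative at $0$ shows that the series weighted by $H[x]$ is
modular of weight $n/2+2$. It has no constant term, and $8\mid n$ (`IsEvenUnimodular.eight_dvd`), so
for $n\le 24$ it vanishes for lack of cusp forms; for $n=32$ this vanishing is the $2$-design
hypothesis. Hence the sum of $H^2[x]$ over a shell is $\operatorname{Tr}(H^2)/n$ times the sum of
$\|x\|^2$.

The second derivative then shows that the series weighted by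
$H[x]^2-\frac{2\operatorname{Tr}(H^2)}{n(n+2)}\|x\|^4$ is a cusp form of weight
$n/2+4\in\{8,12,16,20\}$. It is a multiple of the given form, and the multiple is read off on $L(2)$
(`shellSum_quarticWeight_eq`). Therefore the Hessian is $A\,Q[H]+B\operatorname{Tr}(H^2)$ with
explicit scalars $A$, $B$ (`hessian_formula`), and the eigenvalues correspond by $\mu=A\lambda+B$.
If $A=0$ one also needs that $Q$ has some eigenvector of trace zero
(`QuadraticDesign.exists_isRootEigenvalue`). -/

noncomputable section

namespace GaussianCore

open MeasureTheory Complex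

/-! ### Poisson summation over the integer lattice -/

section Poisson

variable {ι : Type*}

/-- The cast of an integer vector to a real vector. -/
def intVec (k : ι → ℤ) : ι → ℝ := fun i => (k i : ℝ)

/-- The unit cube translated by an integer vector. -/
def unitCell (k : ι → ℤ) : Set (ι → ℝ) := {x | ∀ i, x i ∈ Set.Ioc (k i : ℝ) (k i + 1)}

theorem mem_unitCell_iff (k : ι → ℤ) (x : ι → ℝ) :
    x ∈ unitCell k ↔ ∀ i, ⌈x i⌉ - 1 = k i := by
  refine forall_congr' fun i => ?_
  rw [sub_eq_iff_eq_add, Int.ceil_eq_iff]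
  simp [Set.mem_Ioc]

theorem iUnion_unitCell : (⋃ k : ι → ℤ, unitCell k) = Set.univ := by
  refine Set.eq_univ_of_forall fun x => Set.mem_iUnion.2 ⟨fun i => ⌈x i⌉ - 1, ?_⟩
  simp [mem_unitCell_iff]

theorem pairwise_disjoint_unitCell :
    Pairwise (Function.onFun Disjoint (unitCell : (ι → ℤ) → Set (ι → ℝ))) := by
  intro k l hkl
  rw [Function.onFun, Set.disjoint_left]
  intro x hx hy
  rw [mem_unitCell_iff] at hx hy
  exact hkl (funext fun i => by rw [← hx i, hy i])

/-- The map from `ℝ^ι` to the torus. -/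
def toTorus (v : ι → ℝ) : UnitAddTorus ι := fun i => (v i : UnitAddCircle)

theorem isOpenQuotientMap_toTorus : IsOpenQuotientMap (toTorus : (ι → ℝ) → UnitAddTorus ι) :=
  IsOpenQuotientMap.piMap (f := fun (_ : ι) (x : ℝ) => (x : UnitAddCircle))
    fun _ => QuotientAddGroup.isOpenQuotientMap_mk

theorem exists_add_intVec_of_toTorus_eq {v w : ι → ℝ} (h : toTorus v = toTorus w) :
    ∃ k : ι → ℤ, w = v + intVec k := by
  have (i : ι) : ∃ k : ℤ, w i = v i + k := by
    have hi : (v i : UnitAddCircle) = (w i : UnitAddCircle) := congrFun h i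
    rw [eq_comm, QuotientAddGroup.eq] at hi
    obtain ⟨k, hk⟩ := AddSubgroup.mem_zmultiples_iff.1 hi
    refine ⟨-k, ?_⟩
    simp only [zsmul_eq_mul, mul_one] at hk
    push_cast
    linarith
  choose k hk using this
  exact ⟨k, funext hk⟩

variable [Fintype ι]

theorem measurableSet_unitCell (k : ι → ℤ) : MeasurableSet (unitCell k) :=
  MeasurableSet.univ_pi' fun _ => measurableSet_Ioc

theorem setIntegral_unitCell_zero_comp_add (g : (ι → ℝ) → ℂ) (k : ι → ℤ) :
    ∫ v in unitCell (0 : ι → ℤ), g (v + intVec k) = ∫ v in unitCell k, g v := by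
  rw [← (measurePreserving_add_right volume (intVec k)).setIntegral_preimage_emb
    (MeasurableEquiv.addRight (intVec k)).measurableEmbedding g (unitCell k)]
  congr 2
  ext v
  simp only [unitCell, intVec, Set.mem_ofPred_eq, Set.mem_preimage, Pi.add_apply, Set.mem_Ioc,
    Pi.zero_apply, Int.cast_zero]
  refine forall_congr' fun i => ?_
  constructor <;> rintro ⟨h1, h2⟩ <;> constructor <;> linarith

theorem mFourier_toTorus (m : ι → ℤ) (v : ι → ℝ) :
    UnitAddTorus.mFourier m (toTorus v) = cexp (2 * Real.pi * I * ∑ i, (m i : ℂ) * v i) := by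
  simp only [UnitAddTorus.mFourier, toTorus, ContinuousMap.coe_mk, Finset.mul_sum, Complex.exp_sum,
    fourier_coe_apply]
  refine Finset.prod_congr rfl fun i _ => ?_
  congr 1
  push_cast
  ring

theorem mFourier_toTorus_add_intVec (m k : ι → ℤ) (v : ι → ℝ) :
    UnitAddTorus.mFourier m (toTorus (v + intVec k)) = UnitAddTorus.mFourier m (toTorus v) := by
  congr 1
  funext i
  simp [toTorus, intVec]

/-- Poisson summation for the lattice `ℤ^ι`. -/
theorem tsum_intVec_eq_tsum_integral {f : (ι → ℝ) → ℂ} (hf : Continuous f)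
    (hint : Integrable f)
    (hbd : ∀ R : ℝ, ∃ u : (ι → ℤ) → ℝ, Summable u ∧
      ∀ k v, ‖v‖ ≤ R → ‖f (v + intVec k)‖ ≤ u k)
    (hsum : Summable fun m : ι → ℤ =>
      ∫ v : ι → ℝ, cexp (-(2 * Real.pi * I * ∑ i, (m i : ℂ) * v i)) * f v) :
    ∑' k : ι → ℤ, f (intVec k) =
      ∑' m : ι → ℤ, ∫ v : ι → ℝ, cexp (-(2 * Real.pi * I * ∑ i, (m i : ℂ) * v i)) * f v := by
  -- The periodisation of `f`: continuous because the series converges uniformly on balls, and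
  -- invariant under integer translations.
  set F : (ι → ℝ) → ℂ := fun v => ∑' k : ι → ℤ, f (v + intVec k) with hF
  have hFc : Continuous F := by
    rw [continuous_iff_continuousAt]
    intro v
    obtain ⟨u, hu, hb⟩ := hbd (‖v‖ + 1)
    have h1 : ContinuousOn F (Metric.closedBall 0 (‖v‖ + 1)) := by
      refine continuousOn_tsum (u := u) (fun k => ?_) hu fun k w hw => ?_
      · exact (hf.comp (continuous_id.add continuous_const)).continuousOn
      · exact hb k w (by simpa using hw)
    refine h1.continuousAt (Filter.mem_of_superset (Metric.ball_mem_nhds v one_pos) ?_)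
    intro w hw
    rw [mem_closedBall_zero_iff]
    rw [mem_ball_iff_norm] at hw
    have := norm_le_norm_add_norm_sub v w
    rw [norm_sub_rev] at this
    linarith
  have hFp : ∀ v w, toTorus v = toTorus w → F v = F w := by
    intro v w h
    obtain ⟨l, rfl⟩ := exists_add_intVec_of_toTorus_eq h
    simp only [hF]
    rw [← (Equiv.addLeft l).tsum_eq fun k : ι → ℤ => f (v + intVec k)]
    refine tsum_congr fun k => ?_
    congr 1
    funext i
    simp [intVec, add_assoc]
  -- `F` descends to the torus; periodicity makes the choice of lifts irrelevant, and continuity is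
  -- tested after pulling back along the quotient map.
  let Ft : C(UnitAddTorus ι, ℂ) :=
    ⟨fun x => F (Function.surjInv isOpenQuotientMap_toTorus.surjective x), by
      rw [isOpenQuotientMap_toTorus.isQuotientMap.continuous_iff]
      convert hFc using 1
      funext v
      exact hFp _ _ (Function.surjInv_eq isOpenQuotientMap_toTorus.surjective _)⟩
  have hFt (v : ι → ℝ) : Ft (toTorus v) = F v :=
    hFp _ _ (Function.surjInv_eq isOpenQuotientMap_toTorus.surjective _)
  -- Unfolding: the integral of the periodisation over one cell is the integral of `f` over the
  -- whole space, since the character is itself periodic.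
  have hcoeff (m : ι → ℤ) : UnitAddTorus.mFourierCoeff Ft m =
      ∫ v : ι → ℝ, cexp (-(2 * Real.pi * I * ∑ i, (m i : ℂ) * v i)) * f v := by
    set e : (ι → ℝ) → ℂ := fun v => UnitAddTorus.mFourier (-m) (toTorus v) with he
    have hee (v : ι → ℝ) : e v = cexp (-(2 * Real.pi * I * ∑ i, (m i : ℂ) * v i)) := by
      rw [he]
      simp only
      rw [mFourier_toTorus]
      congr 1
      simp [Finset.sum_neg_distrib]
    have hec : Continuous e := (UnitAddTorus.mFourier (-m)).continuous.comp
      isOpenQuotientMap_toTorus.continuous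
    have hen (v) : ‖e v‖ = 1 := by
      rw [hee, norm_exp]
      simp [Complex.mul_re, Complex.mul_im, ← Complex.ofReal_intCast, ← Complex.ofReal_mul,
        ← Complex.ofReal_sum]
    have hint' : Integrable fun v => e v * f v :=
      hint.bdd_mul hec.aestronglyMeasurable (c := 1)
        (Filter.Eventually.of_forall fun v => (hen v).le)
    simp_rw [← hee]
    rw [UnitAddTorus.mFourierCoeff_eq_integral Ft m 0]
    have hcell : {x : ι → ℝ | ∀ i, x i ∈ Set.Ioc ((0 : ι → ℝ) i) ((0 : ι → ℝ) i + 1)} =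
        unitCell (0 : ι → ℤ) := by
      ext; simp [unitCell]
    rw [hcell]
    have h1 : ∀ v : ι → ℝ, UnitAddTorus.mFourier (-m) (fun i => (v i : UnitAddCircle)) •
        Ft (fun i => (v i : UnitAddCircle)) = ∑' k : ι → ℤ, e (v + intVec k) * f (v + intVec k) := by
      intro v
      have : Ft (fun i => (v i : UnitAddCircle)) = F v := hFt v
      rw [this, hF, smul_eq_mul, ← tsum_mul_left]
      refine tsum_congr fun k => ?_
      rw [he]
      simp only
      rw [mFourier_toTorus_add_intVec]
      rfl
    simp_rw [h1]
    obtain ⟨u, hu, hb⟩ := hbd 1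
    have hcellnorm : ∀ v ∈ unitCell (0 : ι → ℤ), ‖v‖ ≤ 1 := by
      intro v hv
      rw [pi_norm_le_iff_of_nonneg zero_le_one]
      intro i
      have := hv i
      simp only [Pi.zero_apply, Int.cast_zero, zero_add, Set.mem_Ioc] at this
      rw [Real.norm_of_nonneg this.1.le]
      exact this.2
    have hvol : volume (unitCell (0 : ι → ℤ)) ≠ ⊤ := by
      refine ((measure_mono ?_).trans_lt
        (measure_closedBall_lt_top (x := (0 : ι → ℝ)) (r := 1))).ne
      intro v hv
      simpa using hcellnorm v hv
    have hsw : HasSum (fun k : ι → ℤ => ∫ v in unitCell (0 : ι → ℤ),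
        e (v + intVec k) * f (v + intVec k))
        (∫ v in unitCell (0 : ι → ℤ), ∑' k : ι → ℤ, e (v + intVec k) * f (v + intVec k)) := by
      refine hasSum_integral_of_summable_integral_norm (fun k => ?_) ?_
      · exact (hint'.comp_add_right (intVec k)).integrableOn
      · refine Summable.of_nonneg_of_le (fun k => integral_nonneg fun v => norm_nonneg _)
          (fun k => ?_) (hu.mul_right (volume.real (unitCell (0 : ι → ℤ))))
        refine (Real.le_norm_self _).trans
          (norm_setIntegral_le_of_norm_le_const hvol.lt_top fun v hv => ?_)
        rw [norm_norm, norm_mul, hen, one_mul]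
        exact hb k v (hcellnorm v hv)
    have hun : HasSum (fun k : ι → ℤ => ∫ v in unitCell k, e v * f v)
        (∫ v in ⋃ k : ι → ℤ, unitCell k, e v * f v) :=
      hasSum_integral_iUnion (fun k => measurableSet_unitCell k) pairwise_disjoint_unitCell
        hint'.integrableOn
    rw [iUnion_unitCell, setIntegral_univ] at hun
    refine hsw.unique ?_
    convert hun using 2 with k
    exact setIntegral_unitCell_zero_comp_add (fun v => e v * f v) k
  have hs : Summable (UnitAddTorus.mFourierCoeff Ft) := by
    convert hsum using 1
    exact funext hcoeff
  -- With summable coefficients the Fourier series converges pointwise; its value at the origin is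
  -- the claim.
  have key := (UnitAddTorus.hasSum_mFourier_series_apply_of_summable hs (toTorus 0)).tsum_eq
  rw [hFt] at key
  have h0 : F 0 = ∑' k : ι → ℤ, f (intVec k) := by simp [hF]
  rw [← h0, ← key]
  refine tsum_congr fun m => ?_
  rw [hcoeff, mFourier_toTorus]
  simp

end Poisson

end GaussianCore

end

noncomputable section

namespace GaussianCore

open MeasureTheory Complex

/-! ### Convergence of Gaussian lattice sums -/

section LatticeSums

variable {n : ℕ}

/-- The exponential dominates its Taylor term of degree $k$, which reduces the sum to
$\sum\|x\|^{-(j+2r+2)}$ with $r$ the rank. The choice $k=j+r+1$ makes the exponents match, and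
$j+2r+2>r$ gives convergence. -/
theorem summable_norm_pow_mul_exp (L : Submodule ℤ (E n)) [DiscreteTopology L] (j : ℕ) {δ : ℝ}
    (hδ : 0 < δ) :
    Summable fun x : L => ‖(x : E n)‖ ^ j * Real.exp (-(δ * ‖(x : E n)‖ ^ 2)) := by
  set r := Module.finrank ℤ L
  set k := j + r + 1
  have h1 := (ZLattice.summable_norm_zpow L (-((j + 2 * r + 2 : ℕ) : ℤ))
    (by push_cast; omega)).mul_left (k.factorial / δ ^ k : ℝ)
  refine Summable.of_norm_bounded_eventually h1 ?_
  refine (Set.finite_singleton (0 : L)).subset fun x hx => ?_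
  by_contra hx0
  refine hx ?_
  have hpos : 0 < ‖(x : E n)‖ := by
    rw [norm_pos_iff]
    simpa using hx0
  have hexp := Real.pow_div_factorial_le_exp (δ * ‖(x : E n)‖ ^ 2) (by positivity) k
  change ‖‖(x : E n)‖ ^ j * Real.exp (-(δ * ‖(x : E n)‖ ^ 2))‖ ≤
    _ * ‖(x : E n)‖ ^ (-((j + 2 * r + 2 : ℕ) : ℤ))
  rw [Real.norm_of_nonneg (by positivity), Real.exp_neg, zpow_neg, zpow_natCast]
  rw [← div_eq_mul_inv, div_le_iff₀ (Real.exp_pos _), ← div_eq_mul_inv, div_mul_eq_mul_div,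
    le_div_iff₀ (by positivity), ← pow_add]
  rw [div_le_iff₀ (by positivity), mul_pow, ← pow_mul] at hexp
  have hk : j + (j + 2 * r + 2) = 2 * k := by omega
  rw [hk, div_mul_eq_mul_div, le_div_iff₀ (by positivity)]
  linarith

/-- The complex quadratic form `∑ i, c i * ⟪e i, x⟫ ^ 2`. -/
def diagForm (e : OrthonormalBasis (Fin n) ℝ (E n)) (c : Fin n → ℂ) (x : E n) : ℂ :=
  ∑ i, c i * (inner ℝ (e i) x : ℂ) ^ 2

/-- The theta sum of the quadratic form `diagForm e c` over the lattice `L`. -/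
def thetaSum (L : Submodule ℤ (E n)) (e : OrthonormalBasis (Fin n) ℝ (E n)) (c : Fin n → ℂ) : ℂ :=
  ∑' x : L, cexp (-diagForm e c x)

theorem sum_inner_sq (e : OrthonormalBasis (Fin n) ℝ (E n)) (x : E n) :
    ∑ i, inner ℝ (e i) x ^ 2 = ‖x‖ ^ 2 := by
  simpa using e.sum_sq_norm_inner_right x

theorem diagForm_const (e : OrthonormalBasis (Fin n) ℝ (E n)) (w : ℂ) (x : E n) :
    diagForm e (fun _ => w) x = w * (‖x‖ : ℂ) ^ 2 := by
  rw [diagForm, ← Finset.mul_sum, ← ofReal_pow ‖x‖, ← sum_inner_sq e]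
  push_cast
  rfl

theorem le_re_diagForm (e : OrthonormalBasis (Fin n) ℝ (E n)) {c : Fin n → ℂ} {δ : ℝ}
    (hc : ∀ i, δ ≤ (c i).re) (x : E n) : δ * ‖x‖ ^ 2 ≤ (diagForm e c x).re := by
  rw [diagForm, re_sum, ← sum_inner_sq e, Finset.mul_sum]
  refine Finset.sum_le_sum fun i _ => ?_
  rw [← ofReal_pow, re_mul_ofReal]
  exact mul_le_mul_of_nonneg_right (hc i) (sq_nonneg _)

theorem norm_exp_neg_diagForm_le (e : OrthonormalBasis (Fin n) ℝ (E n)) {c : Fin n → ℂ} {δ : ℝ}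
    (hc : ∀ i, δ ≤ (c i).re) (x : E n) :
    ‖cexp (-diagForm e c x)‖ ≤ Real.exp (-(δ * ‖x‖ ^ 2)) := by
  rw [norm_exp, neg_re, Real.exp_le_exp]
  linarith [le_re_diagForm e hc x]

theorem exists_pos_forall_le_re {c : Fin n → ℂ} (hc : ∀ i, 0 < (c i).re) :
    ∃ δ : ℝ, 0 < δ ∧ ∀ i, δ ≤ (c i).re := by
  rcases isEmpty_or_nonempty (Fin n) with h | h
  · exact ⟨1, one_pos, fun i => h.elim i⟩
  · obtain ⟨i, hi⟩ := Finite.exists_min fun i => (c i).re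
    exact ⟨(c i).re, hc i, hi⟩

theorem summable_exp_neg_diagForm (L : Submodule ℤ (E n)) [DiscreteTopology L]
    (e : OrthonormalBasis (Fin n) ℝ (E n)) {c : Fin n → ℂ} (hc : ∀ i, 0 < (c i).re) :
    Summable fun x : L => cexp (-diagForm e c x) := by
  obtain ⟨δ, hδ, hle⟩ := exists_pos_forall_le_re hc
  refine Summable.of_norm_bounded (summable_norm_pow_mul_exp L 0 hδ) fun x => ?_
  rw [pow_zero, one_mul]
  exact norm_exp_neg_diagForm_le e hle x

/-- All terms are positive reals. Nonvanishing allows a theta value to be cancelled when constants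
in functional equations are determined. -/
theorem thetaSum_ofReal_ne_zero (L : Submodule ℤ (E n)) [DiscreteTopology L]
    (e : OrthonormalBasis (Fin n) ℝ (E n)) {t : ℝ} (ht : 0 < t) :
    thetaSum L e (fun _ => t) ≠ 0 := by
  have h1 (x : L) : cexp (-diagForm e (fun _ => (t : ℂ)) x) =
      (Real.exp (-(t * ‖(x : E n)‖ ^ 2)) : ℝ) := by
    rw [diagForm_const]
    push_cast
    rfl
  have hs := summable_norm_pow_mul_exp L 0 ht
  simp only [pow_zero, one_mul] at hs
  rw [thetaSum, tsum_congr h1, ← ofReal_tsum, ofReal_ne_zero]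
  exact (hs.tsum_pos (fun x => (Real.exp_pos _).le) 0 (Real.exp_pos _)).ne'

end LatticeSums

/-! ### Inversion formula for theta sums of self-dual lattices -/

section ThetaInversion

variable {n : ℕ} (L : Submodule ℤ (E n)) [DiscreteTopology L] [IsZLattice ℝ L]

/-- A `ℤ`-basis of a lattice in `ℝⁿ`. -/
def latticeBasis : Module.Basis (Fin n) ℤ L :=
  haveI := ZLattice.module_free ℝ L
  haveI := ZLattice.module_finite ℝ L
  Module.finBasisOfFinrankEq ℤ L ((ZLattice.rank ℝ L).trans finrank_euclideanSpace_fin)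

/-- The real basis given by `latticeBasis`. -/
def latticeRealBasis : Module.Basis (Fin n) ℝ (E n) := (latticeBasis L).ofZLatticeBasis ℝ L

/-- The linear map taking coordinates in the lattice basis to coordinates in the basis `e`. -/
def latticeCoord (e : OrthonormalBasis (Fin n) ℝ (E n)) : (Fin n → ℝ) ≃ₗ[ℝ] (Fin n → ℝ) :=
  (latticeRealBasis L).equivFun.symm.trans
    (e.repr.toLinearEquiv.trans (WithLp.linearEquiv 2 ℝ (Fin n → ℝ)))

theorem latticeCoord_apply (e : OrthonormalBasis (Fin n) ℝ (E n)) (v : Fin n → ℝ) (i : Fin n) :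
    latticeCoord L e v i = inner ℝ (e i) ((latticeRealBasis L).equivFun.symm v) := by
  rw [← OrthonormalBasis.repr_apply_apply]
  rfl

theorem latticeRealBasis_symm_intVec (x : L) :
    (latticeRealBasis L).equivFun.symm (intVec ((latticeBasis L).equivFun x)) = x := by
  rw [LinearEquiv.symm_apply_eq]
  funext i
  simp only [intVec, Module.Basis.equivFun_apply, latticeRealBasis]
  rw [Module.Basis.ofZLatticeBasis_repr_apply]

/-- An integer frequency vector is an integral functional on `L`, so it is represented by a vector
of the dual, that is, of `L`. This turns the dual side of Poisson summation into a sum over `L`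
again. -/
theorem exists_dual_equiv (hL : (L : Set (E n)) = dualSet L) :
    ∃ D : (Fin n → ℤ) ≃ L, ∀ (m : Fin n → ℤ) (v : Fin n → ℝ),
      ∑ i, (m i : ℝ) * v i = inner ℝ (D m : E n) ((latticeRealBasis L).equivFun.symm v) := by
  have hinner (y : E n) (v : Fin n → ℝ) : inner ℝ y ((latticeRealBasis L).equivFun.symm v) =
      ∑ i, inner ℝ y (latticeRealBasis L i) * v i := by
    rw [Module.Basis.equivFun_symm_apply, inner_sum]
    exact Finset.sum_congr rfl fun i _ => by rw [inner_smul_right, mul_comm]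
  have h1 (m : Fin n → ℤ) : ∃ y : L, ∀ v : Fin n → ℝ,
      ∑ i, (m i : ℝ) * v i = inner ℝ (y : E n) ((latticeRealBasis L).equivFun.symm v) := by
    let l : StrongDual ℝ (E n) := LinearMap.toContinuousLinearMap
      ((latticeRealBasis L).constr ℝ (fun i => (m i : ℝ)))
    set y := (InnerProductSpace.toDual ℝ (E n)).symm l with hy
    have hyi (i) : inner ℝ y (latticeRealBasis L i) = m i := by
      rw [hy, InnerProductSpace.toDual_symm_apply]
      simp [l]
    have hyv (v : Fin n → ℝ) : ∑ i, (m i : ℝ) * v i =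
        inner ℝ y ((latticeRealBasis L).equivFun.symm v) := by
      rw [hinner]
      exact Finset.sum_congr rfl fun i _ => by rw [hyi]
    have hyL : y ∈ (L : Set (E n)) := by
      rw [hL]
      intro x hx
      refine ⟨∑ i, m i * (latticeBasis L).equivFun ⟨x, hx⟩ i, ?_⟩
      rw [real_inner_comm]
      have := hyv (intVec ((latticeBasis L).equivFun ⟨x, hx⟩))
      rw [latticeRealBasis_symm_intVec L ⟨x, hx⟩] at this
      rw [← this]
      push_cast
      rfl
    exact ⟨⟨y, hyL⟩, hyv⟩
  choose D hD using h1
  have hDi (m : Fin n → ℤ) (i : Fin n) :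
      inner ℝ (D m : E n) (latticeRealBasis L i) = (m i : ℝ) := by
    have := hD m (Pi.single i 1)
    rw [hinner] at this
    simpa [Pi.single_apply] using this.symm
  refine ⟨Equiv.ofBijective D ⟨fun m m' h => funext fun i => ?_, fun y => ?_⟩, hD⟩
  · have := hDi m i
    rw [h, hDi m' i] at this
    exact_mod_cast this.symm
  · have (i : Fin n) : ∃ k : ℤ, inner ℝ (y : E n) (latticeRealBasis L i) = (k : ℝ) := by
      have hy : (y : E n) ∈ (L : Set (E n)) := y.2
      rw [hL] at hy
      obtain ⟨k, hk⟩ := hy (latticeRealBasis L i) (by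
        rw [latticeRealBasis, Module.Basis.ofZLatticeBasis_apply]
        exact (latticeBasis L i).2)
      exact ⟨k, by rw [real_inner_comm, hk]⟩
    choose m hm using this
    refine ⟨m, Subtype.ext ?_⟩
    refine ext_inner_right ℝ fun x => ?_
    obtain ⟨v, rfl⟩ := (latticeRealBasis L).equivFun.symm.surjective x
    rw [← hD m, hinner]
    exact Finset.sum_congr rfl fun i _ => by rw [hm]

/-- Poisson summation for a Gaussian written in lattice coordinates. The constant is a Jacobian,
independent of `c`; it is left unevaluated because the self-dual point determines it afterwards. -/
theorem thetaSum_eq_const_mul (hL : (L : Set (E n)) = dualSet L)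
    (e : OrthonormalBasis (Fin n) ℝ (E n)) :
    ∃ C : ℂ, ∀ c : Fin n → ℂ, (∀ i, 0 < (c i).re) →
      thetaSum L e c = C * ((∏ i, (Real.pi / c i) ^ (1 / 2 : ℂ)) *
        thetaSum L e fun i => Real.pi ^ 2 / c i) := by
  obtain ⟨D, hD⟩ := exists_dual_equiv L hL
  set A := latticeCoord L e
  have hdet : LinearMap.det (A : (Fin n → ℝ) →ₗ[ℝ] (Fin n → ℝ)) ≠ 0 :=
    (LinearEquiv.isUnit_det' A).ne_zero
  refine ⟨(|(LinearMap.det (A : (Fin n → ℝ) →ₗ[ℝ] (Fin n → ℝ)))⁻¹| : ℝ), fun c hc => ?_⟩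
  have hAint (G : (Fin n → ℝ) → ℂ) : ∫ v, G (A v) =
      (|(LinearMap.det (A : (Fin n → ℝ) →ₗ[ℝ] (Fin n → ℝ)))⁻¹| : ℝ) * ∫ u, G u := by
    have hemb : MeasurableEmbedding (A : (Fin n → ℝ) → (Fin n → ℝ)) :=
      A.toContinuousLinearEquiv.toHomeomorph.measurableEmbedding
    have hmap := Real.map_linearMap_volume_pi_eq_smul_volume_pi hdet
    have h1 := hemb.integral_map (μ := volume) G
    rw [LinearEquiv.coe_coe] at hmap
    rw [hmap, integral_smul_measure, ENNReal.toReal_ofReal (abs_nonneg _)] at h1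
    rw [← h1, real_smul]
  set g : (Fin n → ℝ) → ℂ := fun u => cexp (-∑ i, c i * (u i : ℂ) ^ 2) with hg
  have hgA (v : Fin n → ℝ) :
      g (A v) = cexp (-diagForm e c ((latticeRealBasis L).equivFun.symm v)) := by
    simp only [hg, diagForm, A, latticeCoord_apply]
  have hfour (m : Fin n → ℤ) :
      ∫ v : Fin n → ℝ, cexp (-(2 * Real.pi * I * ∑ i, (m i : ℂ) * v i)) * g (A v) =
      (|(LinearMap.det (A : (Fin n → ℝ) →ₗ[ℝ] (Fin n → ℝ)))⁻¹| : ℝ) *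
        ((∏ i, (Real.pi / c i) ^ (1 / 2 : ℂ)) *
          cexp (-diagForm e (fun i => Real.pi ^ 2 / c i) (D m))) := by
    have h1 (v : Fin n → ℝ) : cexp (-(2 * Real.pi * I * ∑ i, (m i : ℂ) * v i)) * g (A v) =
        (fun u : Fin n → ℝ => cexp (-∑ i, c i * (u i : ℂ) ^ 2 +
          ∑ i, (-(2 * Real.pi * I * inner ℝ (e i) (D m : E n))) * (u i : ℂ))) (A v) := by
      -- Expressing the phase in the coordinates of `e` makes the integrand a product of
      -- one-dimensional Gaussians.
      have h2 : ∑ i, (m i : ℂ) * v i = ∑ i, (inner ℝ (e i) (D m : E n) : ℂ) * (A v i : ℂ) := by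
        have := hD m v
        rw [← e.sum_inner_mul_inner] at this
        simp only [← latticeCoord_apply] at this
        have h3 := congrArg (fun r : ℝ => (r : ℂ)) this
        push_cast at h3
        rw [h3]
        exact Finset.sum_congr rfl fun i _ => by rw [real_inner_comm]
      simp only [hg]
      rw [← Complex.exp_add, add_comm, h2]
      congr 2
      rw [Finset.mul_sum, ← Finset.sum_neg_distrib]
      exact Finset.sum_congr rfl fun i _ => by ring
    rw [integral_congr_ae (Filter.Eventually.of_forall h1)]
    refine (hAint (fun u : Fin n → ℝ => cexp (-∑ i, c i * (u i : ℂ) ^ 2 +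
          ∑ i, (-(2 * Real.pi * I * inner ℝ (e i) (D m : E n))) * (u i : ℂ)))).trans ?_
    rw [GaussianFourier.integral_cexp_neg_sum_mul_add hc, Finset.prod_mul_distrib, ← Complex.exp_sum,
      diagForm, ← Finset.sum_neg_distrib]
    congr 3
    refine Finset.sum_congr rfl fun i _ => ?_
    have hci : c i ≠ 0 := fun h => by simpa [h] using hc i
    field_simp
    rw [I_sq]
    ring
  obtain ⟨δ, hδ, hle⟩ := exists_pos_forall_le_re hc
  have hc' (i) : 0 < ((Real.pi : ℂ) ^ 2 / c i).re := by
    rw [← ofReal_pow, div_re]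
    simp only [ofReal_re, ofReal_im, zero_mul, zero_div, add_zero]
    have h2 : 0 < normSq (c i) := normSq_pos.2 fun h => by simpa [h] using hc i
    have := hc i
    positivity
  have hgc : Continuous fun v => g (A v) := by
    have hA : Continuous A := A.toContinuousLinearEquiv.continuous
    simp only [hg]
    fun_prop
  have hgint : Integrable fun v => g (A v) := by
    have h1 : Integrable g := by
      have := GaussianFourier.integrable_cexp_neg_sum_mul_add hc (fun _ : Fin n => (0 : ℂ))
      simpa [hg] using this
    have hemb : MeasurableEmbedding (A : (Fin n → ℝ) → (Fin n → ℝ)) :=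
      A.toContinuousLinearEquiv.toHomeomorph.measurableEmbedding
    have hmap := Real.map_linearMap_volume_pi_eq_smul_volume_pi hdet
    rw [LinearEquiv.coe_coe] at hmap
    have h2 : Integrable g (Measure.map A volume) := by
      rw [hmap]
      exact h1.smul_measure ENNReal.ofReal_ne_top
    exact hemb.integrable_map_iff.1 h2
  have hP := tsum_intVec_eq_tsum_integral hgc hgint (fun R => ?_) ?_
  · simp_rw [hfour, tsum_mul_left, hgA] at hP
    rw [thetaSum, thetaSum,
      ← D.tsum_eq fun x : L => cexp (-diagForm e (fun i => Real.pi ^ 2 / c i) x), ← hP,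
      ← (latticeBasis L).equivFun.toEquiv.tsum_eq]
    refine tsum_congr fun x => ?_
    have := latticeRealBasis_symm_intVec L x
    simp only [LinearEquiv.coe_toEquiv]
    rw [this]
  · set B := (latticeRealBasis L).equivFun.symm.toContinuousLinearEquiv.toContinuousLinearMap
      with hB
    have hBv (v) : (latticeRealBasis L).equivFun.symm v = B v := rfl
    -- From $\|Bk\|^2\le 2\|Bv+Bk\|^2+2\|Bv\|^2$: half of the decay rate survives, at the cost of a
    -- factor depending only on `R`.
    refine ⟨fun k => Real.exp (δ * (‖B‖ * R) ^ 2) *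
      Real.exp (-(δ / 2 * ‖B (intVec k)‖ ^ 2)), ?_, fun k v hv => ?_⟩
    · refine Summable.mul_left _ ?_
      rw [← (latticeBasis L).equivFun.toEquiv.summable_iff]
      refine (summable_norm_pow_mul_exp L 0 (half_pos hδ)).congr fun x => ?_
      have := latticeRealBasis_symm_intVec L x
      simp only [Function.comp_apply, LinearEquiv.coe_toEquiv]
      rw [← hBv, this, pow_zero, one_mul]
    · change ‖g (A (v + intVec k))‖ ≤ Real.exp (δ * (‖B‖ * R) ^ 2) *
        Real.exp (-(δ / 2 * ‖B (intVec k)‖ ^ 2))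
      rw [hgA, hBv]
      refine (norm_exp_neg_diagForm_le e hle _).trans ?_
      rw [← Real.exp_add, Real.exp_le_exp, map_add]
      have h1 : ‖B v‖ ≤ ‖B‖ * R := (B.le_opNorm v).trans (by gcongr)
      have h2 : ‖B (intVec k)‖ ≤ ‖B v + B (intVec k)‖ + ‖B v‖ := by
        have := norm_sub_le (B v + B (intVec k)) (B v)
        simpa using this
      have h3 : ‖B v‖ ^ 2 ≤ (‖B‖ * R) ^ 2 := by gcongr
      have h4 : ‖B (intVec k)‖ ^ 2 ≤ 2 * ‖B v + B (intVec k)‖ ^ 2 + 2 * ‖B v‖ ^ 2 := by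
        have h5 : ‖B (intVec k)‖ ^ 2 ≤ (‖B v + B (intVec k)‖ + ‖B v‖) ^ 2 := by gcongr
        nlinarith [sq_nonneg (‖B v + B (intVec k)‖ - ‖B v‖)]
      nlinarith
  · simp_rw [hfour]
    refine Summable.mul_left _ (Summable.mul_left _ ?_)
    exact (D.summable_iff (f := fun x : L =>
      cexp (-diagForm e (fun i => Real.pi ^ 2 / c i) x))).2 (summable_exp_neg_diagForm L e hc')

/-- The inversion formula for theta sums of self-dual lattices. -/
theorem thetaSum_inversion (hL : (L : Set (E n)) = dualSet L)
    (e : OrthonormalBasis (Fin n) ℝ (E n)) {z : Fin n → ℂ} (hz : ∀ i, 0 < (z i).re) :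
    thetaSum L e (fun i => Real.pi * z i) = (∏ i, (1 / z i) ^ (1 / 2 : ℂ)) *
        thetaSum L e fun i => Real.pi * (1 / z i) := by
  obtain ⟨C, hC⟩ := thetaSum_eq_const_mul L hL e
  have hpi : (Real.pi : ℂ) ≠ 0 := ofReal_ne_zero.2 Real.pi_ne_zero
  have h1 : C = 1 := by
    -- The point $c_i=\pi$ is fixed by $c\mapsto\pi^2/c$, which forces the constant to be $1$.
    have := hC (fun _ => (Real.pi : ℂ)) (fun _ => by simpa using Real.pi_pos)
    simp only [div_self hpi, one_cpow, Finset.prod_const_one, one_mul, sq,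
      mul_div_cancel_right₀ _ hpi] at this
    exact mul_right_cancel₀ (thetaSum_ofReal_ne_zero L e Real.pi_pos)
      (this.symm.trans (one_mul _).symm)
  rw [hC _ (fun i => by rw [re_ofReal_mul]; exact mul_pos Real.pi_pos (hz i)), h1, one_mul]
  have hz0 (i) : z i ≠ 0 := fun h => by simpa [h] using hz i
  congr 1
  · exact Finset.prod_congr rfl fun i _ => by rw [div_mul_eq_div_div, div_self hpi]
  · congr 1
    funext i
    have := hz0 i
    field_simp

end ThetaInversion

end GaussianCore

end

noncomputable section

namespace GaussianCore

open Complex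

/-! ### Divisibility of the rank by 8 -/

section RankDivisible

variable {n : ℕ} {L : Submodule ℤ (E n)}

theorem IsEvenUnimodular.exists_nat_norm_sq (hL : IsEvenUnimodular L) {x : E n} (hx : x ∈ L) :
    ∃ m : ℕ, ‖x‖ ^ 2 = 2 * (m : ℝ) := by
  obtain ⟨k, hk⟩ := hL.even x hx
  rw [real_inner_self_eq_norm_sq] at hk
  have hk0 : 0 ≤ k := by
    have : (0 : ℝ) ≤ 2 * k := hk ▸ sq_nonneg ‖x‖
    exact_mod_cast (by linarith : (0 : ℝ) ≤ k)
  lift k to ℕ using hk0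
  exact ⟨k, by simpa using hk⟩

theorem IsEvenUnimodular.exp_periodic (hL : IsEvenUnimodular L) {x : E n} (hx : x ∈ L) (z : ℂ) :
    cexp (-(Real.pi * (z + I) * (‖x‖ : ℂ) ^ 2)) = cexp (-(Real.pi * z * (‖x‖ : ℂ) ^ 2)) := by
  obtain ⟨m, hm⟩ := hL.exists_nat_norm_sq hx
  rw [← ofReal_pow, hm, Complex.exp_eq_exp_iff_exists_int]
  refine ⟨-m, ?_⟩
  push_cast
  ring

theorem IsEvenUnimodular.thetaSum_add_I (hL : IsEvenUnimodular L)
    (e : OrthonormalBasis (Fin n) ℝ (E n)) (z : ℂ) :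
    thetaSum L e (fun _ => Real.pi * (z + I)) = thetaSum L e (fun _ => Real.pi * z) := by
  refine tsum_congr fun x => ?_
  rw [diagForm_const, diagForm_const, hL.exp_periodic x.2]

variable [DiscreteTopology L] [IsZLattice ℝ L]

theorem thetaSum_const_inversion (hL : (L : Set (E n)) = dualSet L)
    (e : OrthonormalBasis (Fin n) ℝ (E n)) {z : ℂ} (hz : 0 < z.re) :
    thetaSum L e (fun _ => Real.pi * z) = ((1 / z) ^ (1 / 2 : ℂ)) ^ n *
      thetaSum L e fun _ => Real.pi * (1 / z) := by
  rw [thetaSum_inversion L hL e fun _ => hz, Finset.prod_const, Finset.card_univ, Fintype.card_fin]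

/-- The rank of an even unimodular lattice is divisible by `8`. -/
theorem IsEvenUnimodular.eight_dvd (hL : IsEvenUnimodular L) : 8 ∣ n := by
  let e := EuclideanSpace.basisFun (Fin n) ℝ
  -- The loop $1\to 1+i\to\frac1{1+i}\to\frac{1+i}{2}\to 1-i\to 1$ alternates translation by $i$ and
  -- inversion. The theta value at $1$ is thus multiplied by $w^n$, where `w` collects the two
  -- inversion factors.
  set w : ℂ := (1 / (1 + I)) ^ (1 / 2 : ℂ) * (1 / ((1 + I) / 2)) ^ (1 / 2 : ℂ) with hw
  have hI : (1 + I : ℂ) ≠ 0 := fun h => by simpa using congrArg re h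
  have hww : w ^ 2 = -I := by
    rw [hw, mul_pow]
    have h (a : ℂ) : (a ^ (1 / 2 : ℂ)) ^ 2 = a := by
      have := cpow_nat_inv_pow a two_ne_zero
      rw [one_div]
      exact_mod_cast this
    rw [h, h]
    field_simp
    linear_combination (2 + I) * I_sq
  have h1 : thetaSum L e (fun _ => Real.pi * (1 : ℂ)) =
      w ^ n * thetaSum L e fun _ => Real.pi * (1 : ℂ) := by
    conv_lhs => rw [← hL.thetaSum_add_I e]
    rw [thetaSum_const_inversion hL.unimodular e (z := 1 + I) (by simp),
      ← hL.thetaSum_add_I e (1 / (1 + I))]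
    have h2 : 1 / (1 + I) + I = (1 + I) / 2 := by
      field_simp
      linear_combination I_sq
    have h3 : 1 / ((1 + I) / 2) + I = 1 := by
      field_simp
      linear_combination I_sq
    rw [h2, thetaSum_const_inversion hL.unimodular e (z := (1 + I) / 2) (by simp),
      ← hL.thetaSum_add_I e (1 / ((1 + I) / 2)), h3, ← mul_assoc, ← mul_pow, ← hw]
  have h2 : w ^ n = 1 := by
    have h3 := thetaSum_ofReal_ne_zero L e Real.pi_pos
    rw [mul_one] at h1
    exact mul_right_cancel₀ h3 (h1.symm.trans (one_mul _).symm)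
  -- Since $w^2=-i$, one has $w^4=-1$ and $w^8=1$, so $w^n=1$ means $8\mid n$.
  have h4 : orderOf w = 2 ^ (2 + 1) := by
    refine orderOf_eq_prime_pow ?_ ?_
    · rw [show 2 ^ 2 = 2 * 2 by norm_num, pow_mul, hww, neg_sq, I_sq]
      norm_num
    · rw [show 2 ^ (2 + 1) = 2 * 4 by norm_num, pow_mul, hww, Even.neg_pow (by decide), I_pow_four]
  have := orderOf_dvd_of_pow_eq_one h2
  rwa [h4] at this

end RankDivisible

end GaussianCore

end

noncomputable section

namespace GaussianCore

open Complex

/-! ### Differentiating the deformed theta sum twice -/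

section Deformation

variable {n : ℕ}

/-- The real quadratic form `∑ i, p i * ⟪e i, x⟫ ^ 2`. -/
def realDiagForm (e : OrthonormalBasis (Fin n) ℝ (E n)) (p : Fin n → ℝ) (x : E n) : ℝ :=
  ∑ i, p i * inner ℝ (e i) x ^ 2

theorem diagForm_mul_ofReal (e : OrthonormalBasis (Fin n) ℝ (E n)) (w : ℂ) (p : Fin n → ℝ)
    (x : E n) : diagForm e (fun i => w * p i) x = w * realDiagForm e p x := by
  simp only [diagForm, realDiagForm, ofReal_sum, ofReal_mul, ofReal_pow, Finset.mul_sum, mul_assoc]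

theorem realDiagForm_const (e : OrthonormalBasis (Fin n) ℝ (E n)) (a : ℝ) (x : E n) :
    realDiagForm e (fun _ => a) x = a * ‖x‖ ^ 2 := by
  rw [realDiagForm, ← Finset.mul_sum, sum_inner_sq]

theorem realDiagForm_mono (e : OrthonormalBasis (Fin n) ℝ (E n)) {p r : Fin n → ℝ}
    (h : ∀ i, p i ≤ r i) (x : E n) : realDiagForm e p x ≤ realDiagForm e r x :=
  Finset.sum_le_sum fun i _ => mul_le_mul_of_nonneg_right (h i) (sq_nonneg _)

theorem abs_realDiagForm_le (e : OrthonormalBasis (Fin n) ℝ (E n)) {p : Fin n → ℝ} {B : ℝ}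
    (h : ∀ i, |p i| ≤ B) (x : E n) : |realDiagForm e p x| ≤ B * ‖x‖ ^ 2 := by
  rw [abs_le, ← neg_mul, ← realDiagForm_const e, ← realDiagForm_const e]
  exact ⟨realDiagForm_mono e (fun i => (abs_le.1 (h i)).1) x,
    realDiagForm_mono e (fun i => (abs_le.1 (h i)).2) x⟩

theorem hasDerivAt_realDiagForm (e : OrthonormalBasis (Fin n) ℝ (E n)) (d p : Fin n → ℝ) (x : E n)
    (s : ℝ) : HasDerivAt (fun s => realDiagForm e (fun i => p i * Real.exp (s * d i)) x)
      (realDiagForm e (fun i => p i * d i * Real.exp (s * d i)) x) s := by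
  refine HasDerivAt.fun_sum fun i _ => ?_
  have h1 : HasDerivAt (fun s : ℝ => Real.exp (s * d i)) (Real.exp (s * d i) * d i) s := by
    simpa using ((hasDerivAt_id s).mul_const (d i)).exp
  exact ((h1.const_mul (p i)).mul_const (inner ℝ (e i) x ^ 2)).congr_deriv (by ring)

/-- The quadratic form with coefficients `p i * exp (s * d i)`. -/
def expForm (e : OrthonormalBasis (Fin n) ℝ (E n)) (d p : Fin n → ℝ) (s : ℝ) (x : E n) : ℝ :=
  realDiagForm e (fun i => p i * Real.exp (s * d i)) x

theorem hasDerivAt_expForm (e : OrthonormalBasis (Fin n) ℝ (E n)) (d p : Fin n → ℝ) (x : E n)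
    (s : ℝ) : HasDerivAt (fun s => expForm e d p s x) (expForm e d (fun i => p i * d i) s x) s :=
  hasDerivAt_realDiagForm e d p x s

theorem expForm_zero (e : OrthonormalBasis (Fin n) ℝ (E n)) (d p : Fin n → ℝ) (x : E n) :
    expForm e d p 0 x = realDiagForm e p x := by
  simp [expForm]

/-- A uniform bound for the absolute values of finitely many real numbers. -/
def absBound (d : Fin n → ℝ) : ℝ := ∑ i, |d i|

theorem abs_le_absBound (d : Fin n → ℝ) (i : Fin n) : |d i| ≤ absBound d :=
  Finset.single_le_sum (f := fun i => |d i|) (fun _ _ => abs_nonneg _) (Finset.mem_univ i)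

theorem absBound_nonneg (d : Fin n → ℝ) : 0 ≤ absBound d :=
  Finset.sum_nonneg fun _ _ => abs_nonneg _

theorem abs_mul_le_absBound (d : Fin n → ℝ) {s : ℝ} (hs : s ∈ Set.Ioo (-1 : ℝ) 1) (i : Fin n) :
    |s * d i| ≤ absBound d := by
  rw [abs_mul]
  have h1 : |s| ≤ 1 := abs_le.2 ⟨hs.1.le, hs.2.le⟩
  exact (mul_le_mul h1 (abs_le_absBound d i) (abs_nonneg _) zero_le_one).trans_eq (one_mul _)

theorem abs_expForm_le (e : OrthonormalBasis (Fin n) ℝ (E n)) (d p : Fin n → ℝ) {s : ℝ}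
    (hs : s ∈ Set.Ioo (-1 : ℝ) 1) (x : E n) :
    |expForm e d p s x| ≤ absBound p * Real.exp (absBound d) * ‖x‖ ^ 2 := by
  refine abs_realDiagForm_le e (fun i => ?_) x
  rw [abs_mul, Real.abs_exp]
  exact mul_le_mul (abs_le_absBound p i)
    (Real.exp_le_exp.2 ((le_abs_self _).trans (abs_mul_le_absBound d hs i))) (Real.exp_pos _).le
    (absBound_nonneg p)

theorem le_expForm_one (e : OrthonormalBasis (Fin n) ℝ (E n)) (d : Fin n → ℝ) {s : ℝ}
    (hs : s ∈ Set.Ioo (-1 : ℝ) 1) (x : E n) :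
    Real.exp (-absBound d) * ‖x‖ ^ 2 ≤ expForm e d 1 s x := by
  rw [← realDiagForm_const e]
  refine realDiagForm_mono e (fun i => ?_) x
  rw [Pi.one_apply, one_mul, Real.exp_le_exp]
  exact neg_le_of_neg_le ((neg_le_abs _).trans (abs_mul_le_absBound d hs i))

theorem norm_exp_neg_expForm_le (e : OrthonormalBasis (Fin n) ℝ (E n)) (d : Fin n → ℝ) {s : ℝ}
    (hs : s ∈ Set.Ioo (-1 : ℝ) 1) {w : ℂ} (hw : 0 < w.re) (x : E n) :
    ‖cexp (-(w * expForm e d 1 s x))‖ ≤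
      Real.exp (-(w.re * Real.exp (-absBound d) * ‖x‖ ^ 2)) := by
  rw [norm_exp, neg_re, re_mul_ofReal, Real.exp_le_exp, neg_le_neg_iff, mul_assoc]
  exact mul_le_mul_of_nonneg_left (le_expForm_one e d hs x) hw.le

variable (L : Submodule ℤ (E n))

/-- The theta sum of the deformed lattice, as a function of the deformation parameter. -/
def deformSum (e : OrthonormalBasis (Fin n) ℝ (E n)) (d : Fin n → ℝ) (w : ℂ) (s : ℝ) : ℂ :=
  ∑' x : L, cexp (-(w * expForm e d 1 s x))

/-- The first derivative of `deformSum`. -/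
def deformSumDeriv (e : OrthonormalBasis (Fin n) ℝ (E n)) (d : Fin n → ℝ) (w : ℂ) (s : ℝ) : ℂ :=
  ∑' x : L, -(w * expForm e d d s x) * cexp (-(w * expForm e d 1 s x))

/-- The second derivative of `deformSum`. -/
def deformSumDeriv2 (e : OrthonormalBasis (Fin n) ℝ (E n)) (d : Fin n → ℝ) (w : ℂ) (s : ℝ) : ℂ :=
  ∑' x : L, (w ^ 2 * (expForm e d d s x : ℂ) ^ 2 - w * expForm e d (fun i => d i * d i) s x) *
    cexp (-(w * expForm e d 1 s x))

theorem hasDerivAt_deformTerm (e : OrthonormalBasis (Fin n) ℝ (E n)) (d : Fin n → ℝ) (w : ℂ)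
    (x : E n) (s : ℝ) : HasDerivAt (fun s => cexp (-(w * expForm e d 1 s x)))
      (-(w * expForm e d d s x) * cexp (-(w * expForm e d 1 s x))) s := by
  have h1 := (hasDerivAt_expForm e d 1 x s).ofReal_comp
  refine ((h1.const_mul w).fun_neg).cexp.congr_deriv ?_
  rw [mul_comm]
  simp

theorem hasDerivAt_deformTerm_deriv (e : OrthonormalBasis (Fin n) ℝ (E n)) (d : Fin n → ℝ) (w : ℂ)
    (x : E n) (s : ℝ) :
    HasDerivAt (fun s => -(w * expForm e d d s x) * cexp (-(w * expForm e d 1 s x)))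
      ((w ^ 2 * (expForm e d d s x : ℂ) ^ 2 - w * expForm e d (fun i => d i * d i) s x) *
    cexp (-(w * expForm e d 1 s x))) s := by
  have h1 := (hasDerivAt_expForm e d d x s).ofReal_comp
  exact (((h1.const_mul w).fun_neg).fun_mul (hasDerivAt_deformTerm e d w x s)).congr_deriv (by ring)

variable [DiscreteTopology L]

theorem summable_deformSum (e : OrthonormalBasis (Fin n) ℝ (E n)) (d : Fin n → ℝ) {w : ℂ}
    (hw : 0 < w.re) (s : ℝ) : Summable fun x : L => cexp (-(w * expForm e d 1 s x)) := by
  have h := summable_exp_neg_diagForm L e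
    (c := fun i => w * ((1 : Fin n → ℝ) i * Real.exp (s * d i) : ℝ)) fun i => by
      rw [re_mul_ofReal, Pi.one_apply, one_mul]
      positivity
  simpa only [diagForm_mul_ofReal, expForm] using h

/-- A majorant uniform in the deformation parameter, as termwise differentiation requires;
restricting to $(-1,1)$ keeps $e^{sd_i}$ between fixed positive bounds. -/
theorem exists_summable_bound_deformSumDeriv (e : OrthonormalBasis (Fin n) ℝ (E n))
    (d : Fin n → ℝ) {w : ℂ} (hw : 0 < w.re) : ∃ u : L → ℝ, Summable u ∧
      ∀ (x : L), ∀ s ∈ Set.Ioo (-1 : ℝ) 1,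
        ‖-(w * expForm e d d s x) * cexp (-(w * expForm e d 1 s x))‖ ≤ u x := by
  have hδ : 0 < w.re * Real.exp (-absBound d) := mul_pos hw (Real.exp_pos _)
  refine ⟨_, (summable_norm_pow_mul_exp L 2 hδ).mul_left
    (‖w‖ * (absBound d * Real.exp (absBound d))), fun x s hs => ?_⟩
  rw [norm_mul, norm_neg, norm_mul, norm_real, Real.norm_eq_abs]
  exact (mul_le_mul (mul_le_mul_of_nonneg_left (abs_expForm_le e d d hs x) (norm_nonneg w))
    (norm_exp_neg_expForm_le e d hs hw x) (norm_nonneg _)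
    (by have := absBound_nonneg d; positivity)).trans_eq (by ring)

theorem exists_summable_bound_deformSumDeriv2 (e : OrthonormalBasis (Fin n) ℝ (E n))
    (d : Fin n → ℝ) {w : ℂ} (hw : 0 < w.re) : ∃ u : L → ℝ, Summable u ∧
      ∀ (x : L), ∀ s ∈ Set.Ioo (-1 : ℝ) 1,
        ‖(w ^ 2 * (expForm e d d s x : ℂ) ^ 2 - w * expForm e d (fun i => d i * d i) s x) *
          cexp (-(w * expForm e d 1 s x))‖ ≤ u x := by
  have hδ : 0 < w.re * Real.exp (-absBound d) := mul_pos hw (Real.exp_pos _)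
  set B := absBound d * Real.exp (absBound d)
  set B' := absBound (fun i => d i * d i) * Real.exp (absBound d)
  have hB : 0 ≤ B := mul_nonneg (absBound_nonneg d) (Real.exp_pos _).le
  have hB' : 0 ≤ B' := mul_nonneg (absBound_nonneg _) (Real.exp_pos _).le
  refine ⟨_, ((summable_norm_pow_mul_exp L 4 hδ).mul_left (‖w‖ ^ 2 * B ^ 2)).add
    ((summable_norm_pow_mul_exp L 2 hδ).mul_left (‖w‖ * B')), fun x s hs => ?_⟩
  have h1 := abs_expForm_le e d d hs x
  have h2 := abs_expForm_le e d (fun i => d i * d i) hs x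
  rw [norm_mul, ← mul_assoc, ← mul_assoc, ← add_mul]
  refine mul_le_mul ?_ (norm_exp_neg_expForm_le e d hs hw x) (norm_nonneg _) (by positivity)
  refine (norm_sub_le _ _).trans ?_
  rw [norm_mul, norm_mul, norm_pow, norm_pow, norm_real, norm_real, Real.norm_eq_abs,
    Real.norm_eq_abs, mul_assoc (‖w‖ ^ 2), mul_assoc ‖w‖,
    show B ^ 2 * ‖(x : E n)‖ ^ 4 = (B * ‖(x : E n)‖ ^ 2) ^ 2 by ring]
  gcongr

theorem hasDerivAt_deformSum (e : OrthonormalBasis (Fin n) ℝ (E n)) (d : Fin n → ℝ) {w : ℂ}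
    (hw : 0 < w.re) {s : ℝ} (hs : s ∈ Set.Ioo (-1 : ℝ) 1) :
    HasDerivAt (deformSum L e d w) (deformSumDeriv L e d w s) s := by
  obtain ⟨u, hu, hb⟩ := exists_summable_bound_deformSumDeriv L e d hw
  exact hasDerivAt_tsum_of_isPreconnected hu isOpen_Ioo isPreconnected_Ioo
    (fun x s _ => hasDerivAt_deformTerm e d w x s) hb hs (summable_deformSum L e d hw s) hs

theorem hasDerivAt_deformSumDeriv (e : OrthonormalBasis (Fin n) ℝ (E n)) (d : Fin n → ℝ) {w : ℂ}
    (hw : 0 < w.re) {s : ℝ} (hs : s ∈ Set.Ioo (-1 : ℝ) 1) :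
    HasDerivAt (deformSumDeriv L e d w) (deformSumDeriv2 L e d w s) s := by
  obtain ⟨u, hu, hb⟩ := exists_summable_bound_deformSumDeriv2 L e d hw
  obtain ⟨u', hu', hb'⟩ := exists_summable_bound_deformSumDeriv L e d hw
  exact hasDerivAt_tsum_of_isPreconnected hu isOpen_Ioo isPreconnected_Ioo
    (fun x s _ => hasDerivAt_deformTerm_deriv e d w x s) hb hs
    (Summable.of_norm_bounded hu' fun x => hb' x s hs) hs

theorem continuousOn_deformSumDeriv2 (e : OrthonormalBasis (Fin n) ℝ (E n)) (d : Fin n → ℝ) {w : ℂ}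
    (hw : 0 < w.re) : ContinuousOn (deformSumDeriv2 L e d w) (Set.Ioo (-1 : ℝ) 1) := by
  obtain ⟨u, hu, hb⟩ := exists_summable_bound_deformSumDeriv2 L e d hw
  refine continuousOn_tsum (fun x => ?_) hu hb
  have h (p : Fin n → ℝ) : Continuous fun s => expForm e d p s (x : E n) :=
    continuous_iff_continuousAt.2 fun s => (hasDerivAt_expForm e d p x s).continuousAt
  have h1 := h d
  have h2 := h 1
  have h3 := h fun i => d i * d i
  exact Continuous.continuousOn (by fun_prop)

theorem contDiffOn_deformSum (e : OrthonormalBasis (Fin n) ℝ (E n)) (d : Fin n → ℝ) {w : ℂ}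
    (hw : 0 < w.re) : ContDiffOn ℝ 2 (deformSum L e d w) (Set.Ioo (-1 : ℝ) 1) := by
  rw [show (2 : WithTop ℕ∞) = 1 + 1 by norm_num, contDiffOn_succ_iff_deriv_of_isOpen isOpen_Ioo]
  refine ⟨fun s hs => (hasDerivAt_deformSum L e d hw hs).differentiableAt.differentiableWithinAt,
    by simp, ?_⟩
  have h1 : ContDiffOn ℝ 1 (deformSumDeriv L e d w) (Set.Ioo (-1 : ℝ) 1) := by
    rw [show (1 : WithTop ℕ∞) = 0 + 1 by norm_num, contDiffOn_succ_iff_deriv_of_isOpen isOpen_Ioo]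
    refine ⟨fun s hs =>
      (hasDerivAt_deformSumDeriv L e d hw hs).differentiableAt.differentiableWithinAt, by simp, ?_⟩
    rw [contDiffOn_zero]
    exact (continuousOn_deformSumDeriv2 L e d hw).congr fun s hs =>
      (hasDerivAt_deformSumDeriv L e d hw hs).deriv
  exact h1.congr fun s hs => (hasDerivAt_deformSum L e d hw hs).deriv

end Deformation

/-! ### Inversion formula along a deformation, and its derivatives -/

section DeformationInversion

variable {n : ℕ} {L : Submodule ℤ (E n)} [DiscreteTopology L] [IsZLattice ℝ L]

/-- A positive real factor does not change the argument, so the principal square root is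
multiplicative here. -/
theorem ofReal_mul_cpow_half {r : ℝ} (hr : 0 < r) {a : ℂ} (ha : a ≠ 0) :
    (r * a) ^ (1 / 2 : ℂ) = (Real.exp (Real.log r / 2) : ℝ) * a ^ (1 / 2 : ℂ) := by
  rw [cpow_def_of_ne_zero (mul_ne_zero (ofReal_ne_zero.2 hr.ne') ha), cpow_def_of_ne_zero ha,
    log_ofReal_mul hr ha, add_mul, Complex.exp_add]
  push_cast
  ring_nf

/-- The inversion formula at $z_i=ze^{sd_i}$: reciprocals replace $s$ by $-s$, and the product of
the factors $e^{-sd_i/2}$ gives the trace exponential, which is moved to the left. -/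
theorem deformSum_inversion (hL : (L : Set (E n)) = dualSet L)
    (e : OrthonormalBasis (Fin n) ℝ (E n)) (d : Fin n → ℝ) {z : ℂ} (hz : 0 < z.re) (s : ℝ) :
    cexp (s * ((∑ i, d i : ℝ) / 2)) * deformSum L e d (Real.pi * z) s =
      ((1 / z) ^ (1 / 2 : ℂ)) ^ n * deformSum L e d (Real.pi * (1 / z)) (-s) := by
  have hz0 : z ≠ 0 := fun h => by simp [h] at hz
  have h1 := thetaSum_inversion L hL e (z := fun i => z * (Real.exp (s * d i) : ℝ)) fun i => by
    rw [re_mul_ofReal]; positivity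
  have h2 (w : ℂ) (t : ℝ) :
      deformSum L e d w t = thetaSum L e fun i => w * (Real.exp (t * d i) : ℝ) := by
    refine tsum_congr fun x => ?_
    rw [diagForm_mul_ofReal]
    simp [expForm]
  rw [h2, h2]
  simp only [← mul_assoc] at h1
  rw [h1]
  have h3 (i : Fin n) : 1 / (z * (Real.exp (s * d i) : ℝ)) =
      (Real.exp (-s * d i) : ℝ) * (1 / z) := by
    rw [neg_mul, Real.exp_neg]
    push_cast
    rw [one_div, mul_inv, one_div, mul_comm]
  have h4 : ∏ i, (1 / (z * (Real.exp (s * d i) : ℝ))) ^ (1 / 2 : ℂ) =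
      cexp (-(s * ((∑ i, d i : ℝ) / 2))) * ((1 / z) ^ (1 / 2 : ℂ)) ^ n := by
    have h5 (i : Fin n) : (1 / (z * (Real.exp (s * d i) : ℝ))) ^ (1 / 2 : ℂ) =
        cexp (-(s * (d i / 2))) * (1 / z) ^ (1 / 2 : ℂ) := by
      rw [h3, ofReal_mul_cpow_half (Real.exp_pos _) (one_div_ne_zero hz0), Real.log_exp]
      push_cast
      ring_nf
    rw [Finset.prod_congr rfl fun i _ => h5 i, Finset.prod_mul_distrib, Finset.prod_const,
      Finset.card_univ, Fintype.card_fin, ← Complex.exp_sum]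
    congr 2
    push_cast
    rw [Finset.sum_div, Finset.mul_sum, ← Finset.sum_neg_distrib]
  rw [h4, ← mul_assoc, ← mul_assoc, ← Complex.exp_add, add_neg_cancel, Complex.exp_zero, one_mul]
  congr 2
  funext i
  rw [h3]
  ring

/-- The $s$-derivative of the inversion formula; the sign comes from $-s$. It is kept for all $s$
near $0$ so that it can be differentiated again. -/
theorem deformSumDeriv_inversion (hL : (L : Set (E n)) = dualSet L)
    (e : OrthonormalBasis (Fin n) ℝ (E n)) (d : Fin n → ℝ) {z : ℂ} (hz : 0 < z.re) {s : ℝ}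
    (hs : s ∈ Set.Ioo (-1 : ℝ) 1) :
    cexp (s * ((∑ i, d i : ℝ) / 2)) * (deformSumDeriv L e d (Real.pi * z) s +
      (∑ i, d i : ℝ) / 2 * deformSum L e d (Real.pi * z) s) =
      -(((1 / z) ^ (1 / 2 : ℂ)) ^ n * deformSumDeriv L e d (Real.pi * (1 / z)) (-s)) := by
  set D : ℂ := (∑ i, d i : ℝ) / 2
  have hz1 : 0 < (Real.pi * z).re := by rw [re_ofReal_mul]; positivity
  have hz2 : 0 < (Real.pi * (1 / z)).re := by
    rw [re_ofReal_mul, one_div, inv_re]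
    have : 0 < normSq z := normSq_pos.2 fun h => by simp [h] at hz
    positivity
  have hs' : -s ∈ Set.Ioo (-1 : ℝ) 1 := ⟨by linarith [hs.2], by linarith [hs.1]⟩
  have h1 : HasDerivAt (fun s : ℝ => cexp (s * D)) (cexp (s * D) * D) s := by
    have := (((hasDerivAt_id s).ofReal_comp).mul_const D).cexp
    simpa using this
  have h2 := h1.mul (hasDerivAt_deformSum L e d hz1 hs)
  have h3 := ((hasDerivAt_deformSum L e d hz2 hs').scomp s (hasDerivAt_neg s)).const_mul
    (((1 / z) ^ (1 / 2 : ℂ)) ^ n)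
  have h4 : ((fun s : ℝ => cexp (s * D)) * deformSum L e d (Real.pi * z)) =
      fun s => ((1 / z) ^ (1 / 2 : ℂ)) ^ n * deformSum L e d (Real.pi * (1 / z)) (-s) :=
    funext fun s => deformSum_inversion hL e d hz s
  rw [h4] at h2
  have h5 := h2.unique h3
  rw [neg_one_smul] at h5
  linear_combination h5

/-- The trace is not assumed zero, because the case $d=1$ supplies the transformation laws of the
radial weights. -/
theorem deformSumDeriv2_inversion (hL : (L : Set (E n)) = dualSet L)
    (e : OrthonormalBasis (Fin n) ℝ (E n)) (d : Fin n → ℝ) {z : ℂ} (hz : 0 < z.re) :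
    deformSumDeriv2 L e d (Real.pi * z) 0 +
        (∑ i, d i : ℝ) * deformSumDeriv L e d (Real.pi * z) 0 +
        ((∑ i, d i : ℝ) : ℂ) ^ 2 / 4 * deformSum L e d (Real.pi * z) 0 =
      ((1 / z) ^ (1 / 2 : ℂ)) ^ n * deformSumDeriv2 L e d (Real.pi * (1 / z)) 0 := by
  set D : ℂ := ((∑ i, d i : ℝ) : ℂ)
  have h0 : (0 : ℝ) ∈ Set.Ioo (-1 : ℝ) 1 := by simp
  have h0' : -(0 : ℝ) ∈ Set.Ioo (-1 : ℝ) 1 := by simp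
  have hz1 : 0 < (Real.pi * z).re := by rw [re_ofReal_mul]; positivity
  have hz2 : 0 < (Real.pi * (1 / z)).re := by
    rw [re_ofReal_mul, one_div, inv_re]
    have : 0 < normSq z := normSq_pos.2 fun h => by simp [h] at hz
    positivity
  have h1 : HasDerivAt (fun s : ℝ => cexp (s * (D / 2))) (cexp ((0 : ℝ) * (D / 2)) * (D / 2)) 0 := by
    have := (((hasDerivAt_id (0 : ℝ)).ofReal_comp).mul_const (D / 2)).cexp
    simpa using this
  have h2 := h1.mul ((hasDerivAt_deformSumDeriv L e d hz1 h0).add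
    ((hasDerivAt_deformSum L e d hz1 h0).const_mul (D / 2)))
  have h3 := (((hasDerivAt_deformSumDeriv L e d hz2 h0').scomp 0 (hasDerivAt_neg 0)).const_mul
    (((1 / z) ^ (1 / 2 : ℂ)) ^ n)).neg
  have h4 : (-fun s => ((1 / z) ^ (1 / 2 : ℂ)) ^ n *
      deformSumDeriv L e d (Real.pi * (1 / z)) (-s)) =ᶠ[nhds 0]
      ((fun s : ℝ => cexp (s * (D / 2))) * (deformSumDeriv L e d (Real.pi * z) +
        fun s => D / 2 * deformSum L e d (Real.pi * z) s)) := by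
    filter_upwards [isOpen_Ioo.mem_nhds h0] with s hs
    exact (deformSumDeriv_inversion hL e d hz hs).symm
  have h5 := (h2.congr_of_eventuallyEq h4).unique h3
  simp only [Pi.add_apply, ofReal_zero, zero_mul, Complex.exp_zero, one_mul, neg_zero, neg_one_smul] at h5
  linear_combination h5

end DeformationInversion

end GaussianCore

end

noncomputable section

namespace GaussianCore

open Complex ModularForm
open UpperHalfPlane hiding I
open Filter hiding map_one
open scoped Real ModularForm Manifold

/-! ### Weighted theta series as modular forms -/

section WeightedTheta

variable {n : ℕ}

/-- Functions on `ℝⁿ` bounded by a multiple of a power of the norm. -/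
def PolyBounded (P : E n → ℝ) : Prop := ∃ (B : ℝ) (j : ℕ), ∀ x, |P x| ≤ B * ‖x‖ ^ j

/-- The theta sum of the lattice `L` with weights `P`. -/
def weightedSum (L : Submodule ℤ (E n)) (P : E n → ℝ) (w : ℂ) : ℂ :=
  ∑' x : L, (P x : ℂ) * cexp (-(w * (‖(x : E n)‖ : ℂ) ^ 2))

/-- The sum of the weights `P` over the shell `L(2m)`. -/
def shellSum (L : Submodule ℤ (E n)) (P : E n → ℝ) (m : ℕ) : ℝ :=
  ∑ᶠ x ∈ shell L (2 * (m : ℝ)), P x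

theorem mem_shell_iff (L : Submodule ℤ (E n)) {x : E n} {s : ℝ} : x ∈ shell L s ↔ x ∈ L ∧ ‖x‖ ^ 2 = s := by
  rw [← real_inner_self_eq_norm_sq]; rfl

/-- Half of the squared norm of a vector of an even lattice. -/
def IsEvenUnimodular.halfNorm {L : Submodule ℤ (E n)} (hL : IsEvenUnimodular L) (x : L) : ℕ :=
  (hL.exists_nat_norm_sq x.2).choose

theorem IsEvenUnimodular.halfNorm_spec {L : Submodule ℤ (E n)} (hL : IsEvenUnimodular L) (x : L) :
    ‖(x : E n)‖ ^ 2 = 2 * (hL.halfNorm x : ℝ) :=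
  (hL.exists_nat_norm_sq x.2).choose_spec

theorem IsEvenUnimodular.weightedSum_add_I {L : Submodule ℤ (E n)}
    (hL : IsEvenUnimodular L) (P : E n → ℝ) (z : ℂ) :
    weightedSum L P (π * (z + I)) = weightedSum L P (π * z) :=
  tsum_congr fun x => by rw [hL.exp_periodic x.2]

/-- The theta function with weights `P`, as a function on the upper half plane. -/
def weightedTheta (L : Submodule ℤ (E n)) (P : E n → ℝ) (τ : ℍ) : ℂ :=
  weightedSum L P (π * (-I * τ))

theorem re_neg_I_mul_pos (τ : ℍ) : 0 < (-I * (τ : ℂ)).re := by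
  simpa using τ.im_pos

theorem re_pi_mul_pos {z : ℂ} (hz : 0 < z.re) : 0 < ((π : ℂ) * z).re := by
  rw [re_ofReal_mul]
  exact mul_pos Real.pi_pos hz

/-- With $z=-i\tau$, the map $\tau\mapsto-1/\tau$ becomes $z\mapsto 1/z$; the condition on `σ`
cancels the factor $(-i)^k$ from $z^k=(-i\tau)^k$. -/
theorem weightedTheta_slash_S {L : Submodule ℤ (E n)} {P : E n → ℝ} {k : ℕ} {σ : ℂ}
    (hσ : σ * (-I) ^ k = 1) (hS : ∀ z : ℂ, 0 < z.re →
      weightedSum L P (π * (1 / z)) = σ * z ^ k * weightedSum L P (π * z)) :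
    weightedTheta L P ∣[(k : ℤ)] ModularGroup.S = weightedTheta L P := by
  ext z
  suffices weightedSum L P (π * (-I * (-(z : ℂ)⁻¹))) * ((z : ℂ) ^ k)⁻¹ = weightedTheta L P z by
    rw [SL_slash_apply, UpperHalfPlane.modular_S_smul, ModularGroup.denom_S]
    simpa [weightedTheta] using this
  have hz : (z : ℂ) ≠ 0 := z.ne_zero
  have h1 : -I * (-(z : ℂ)⁻¹) = 1 / (-I * z) := by
    field_simp
    rw [I_sq]
  rw [h1, hS _ (re_neg_I_mul_pos z), mul_pow, ← weightedTheta, ← mul_assoc, hσ, one_mul]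
  field_simp

theorem IsEvenUnimodular.weightedTheta_slash_T {L : Submodule ℤ (E n)}
    (hL : IsEvenUnimodular L) (P : E n → ℝ) (k : ℤ) :
    weightedTheta L P ∣[k] ModularGroup.T = weightedTheta L P := by
  ext z
  have hT : denom ModularGroup.T z = 1 := by
    rw [ModularGroup.denom_apply]
    simp [ModularGroup.T]
  rw [SL_slash_apply, hT, modular_T_smul]
  simp only [weightedTheta]
  rw [← hL.weightedSum_add_I P (-I * ((1 : ℝ) +ᵥ z : ℍ))]
  simp
  ring_nf

variable (L : Submodule ℤ (E n)) [DiscreteTopology L] {P : E n → ℝ}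

theorem PolyBounded.exists_summable_bound (hP : PolyBounded P) {δ : ℝ} (hδ : 0 < δ) :
    ∃ u : L → ℝ, Summable u ∧ ∀ (x : L) (w : ℂ), δ ≤ w.re →
      ‖(P x : ℂ) * cexp (-(w * (‖(x : E n)‖ : ℂ) ^ 2))‖ ≤ u x := by
  obtain ⟨B, j, hB⟩ := hP
  refine ⟨_, (summable_norm_pow_mul_exp L j hδ).mul_left B, fun x w hw => ?_⟩
  rw [norm_mul, norm_real, Real.norm_eq_abs, ← mul_assoc, norm_exp, neg_re, ← ofReal_pow,
    re_mul_ofReal]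
  have h1 := hB x
  exact mul_le_mul h1 (Real.exp_le_exp.2 (neg_le_neg (by gcongr))) (Real.exp_pos _).le
    ((abs_nonneg _).trans h1)

theorem PolyBounded.summable (hP : PolyBounded P) {w : ℂ} (hw : 0 < w.re) :
    Summable fun x : L => (P x : ℂ) * cexp (-(w * (‖(x : E n)‖ : ℂ) ^ 2)) := by
  obtain ⟨u, hu, hb⟩ := hP.exists_summable_bound L hw
  exact Summable.of_norm_bounded hu fun x => hb x w le_rfl

theorem PolyBounded.differentiableOn_weightedSum (hP : PolyBounded P) :
    DifferentiableOn ℂ (weightedSum L P) {w : ℂ | 0 < w.re} := by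
  intro w hw
  have hw' : 0 < w.re / 2 := half_pos hw
  obtain ⟨u, hu, hb⟩ := hP.exists_summable_bound L hw'
  have hopen : IsOpen {w' : ℂ | w.re / 2 < w'.re} := isOpen_lt continuous_const continuous_re
  have h1 : DifferentiableOn ℂ (weightedSum L P) {w' : ℂ | w.re / 2 < w'.re} := by
    refine differentiableOn_tsum_of_summable_norm hu (fun x => ?_) hopen
      fun x w' (h : _ < _) => hb x w' h.le
    fun_prop
  exact (h1.differentiableAt (hopen.mem_nhds (half_lt_self (show 0 < w.re from hw)))).differentiableWithinAt

theorem shellSum_eq_sum (P : E n → ℝ) (m : ℕ) :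
    shellSum L P m = ∑ x ∈ (shell_finite L (2 * (m : ℝ))).toFinset, P x := by
  rw [shellSum, finsum_mem_eq_finite_toFinset_sum]

variable {L}

/-- Absolute convergence permits summing over the fibres of the half norm, which are the shells
$L(2m)$. -/
theorem IsEvenUnimodular.hasSum_shellSum (hL : IsEvenUnimodular L) (hP : PolyBounded P) {w : ℂ}
    (hw : 0 < w.re) : HasSum (fun m : ℕ => (shellSum L P m : ℂ) * cexp (-(w * (2 * m))))
      (weightedSum L P w) := by
  have h0 := (hP.summable L hw).hasSum.tsum_fiberwise hL.halfNorm
  refine Eq.mpr (congrArg (fun g => HasSum g _) (funext fun m => ?_)) h0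
  have hmem (x : L) : x ∈ hL.halfNorm ⁻¹' {m} ↔ (x : E n) ∈ shell L (2 * (m : ℝ)) := by
    rw [mem_shell_iff, hL.halfNorm_spec]
    simp
  let φ : hL.halfNorm ⁻¹' {m} ≃ (shell_finite L (2 * (m : ℝ))).toFinset :=
    { toFun := fun x => ⟨x.1, by simpa using (hmem x.1).1 x.2⟩
      invFun := fun x => ⟨⟨x.1, ((shell_finite L _).mem_toFinset.1 x.2).1⟩,
        (hmem _).2 ((shell_finite L _).mem_toFinset.1 x.2)⟩
      left_inv := fun x => rfl
      right_inv := fun x => rfl }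
  have h1 : ∑' x : (shell_finite L (2 * (m : ℝ))).toFinset,
      (P x : ℂ) * cexp (-(w * (‖(x : E n)‖ : ℂ) ^ 2)) =
      (shellSum L P m : ℂ) * cexp (-(w * (2 * m))) := by
    rw [Finset.tsum_subtype (shell_finite L (2 * (m : ℝ))).toFinset
      fun x : E n => (P x : ℂ) * cexp (-(w * (‖x‖ : ℂ) ^ 2)), shellSum_eq_sum, ofReal_sum,
      Finset.sum_mul]
    refine Finset.sum_congr rfl fun x hx => ?_
    rw [Set.Finite.mem_toFinset, mem_shell_iff] at hx
    rw [← ofReal_pow, hx.2]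
    push_cast
    rfl
  rw [← h1, ← φ.tsum_eq]
  rfl

theorem IsEvenUnimodular.hasSum_weightedTheta (hL : IsEvenUnimodular L) (hP : PolyBounded P)
    (τ : ℍ) : HasSum (fun m : ℕ => (shellSum L P m : ℂ) • Function.Periodic.qParam 1 τ ^ m)
      (weightedTheta L P τ) := by
  refine Eq.mpr (congrArg (fun g => HasSum g _) (funext fun m => ?_))
    (hL.hasSum_shellSum hP (re_pi_mul_pos (re_neg_I_mul_pos τ)))
  rw [Function.Periodic.qParam, ← Complex.exp_nat_mul, smul_eq_mul]
  congr 2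
  push_cast
  ring

theorem mdifferentiable_weightedTheta (hP : PolyBounded P) : MDiff (weightedTheta L P) := by
  rw [UpperHalfPlane.mdifferentiable_iff]
  have h1 : DifferentiableOn ℂ (fun τ : ℂ => weightedSum L P (π * (-I * τ))) {z | 0 < z.im} := by
    refine (hP.differentiableOn_weightedSum L).comp (t := {w : ℂ | 0 < w.re})
      (f := fun τ : ℂ => (π : ℂ) * (-I * τ)) (by fun_prop) fun τ hτ => ?_
    exact re_pi_mul_pos (re_neg_I_mul_pos ⟨τ, hτ⟩)
  refine h1.congr fun z hz => ?_
  rw [Function.comp_apply, weightedTheta, ofComplex_apply_of_im_pos hz]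

/-- The weighted theta function as a modular form. -/
def thetaModularForm (hL : IsEvenUnimodular L) (hP : PolyBounded P) {k : ℕ} {σ : ℂ}
    (hσ : σ * (-I) ^ k = 1) (hS : ∀ z : ℂ, 0 < z.re →
      weightedSum L P (π * (1 / z)) = σ * z ^ k * weightedSum L P (π * z)) :
    ModularForm 𝒮ℒ (k : ℤ) where
  toFun := weightedTheta L P
  slash_action_eq' A hA := by
    obtain ⟨A, rfl⟩ := hA
    exact SlashInvariantForm.slash_action_generators_SL2Z (weightedTheta_slash_S hσ hS)
      (hL.weightedTheta_slash_T P k) A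
  holo' := mdifferentiable_weightedTheta hP
  -- Every cusp is a translate of $\infty$ under $\mathrm{SL}_2(\mathbb Z)$; by invariance only
  -- $\infty$ matters, where the expansion has no negative powers of $q$.
  bdd_at_cusps' {c} hc := by
    rw [Subgroup.IsArithmetic.isCusp_iff_isCusp_SL2Z] at hc
    rw [OnePoint.isBoundedAt_iff_forall_SL2Z hc]
    intro γ _
    rw [SlashInvariantForm.slash_action_generators_SL2Z (weightedTheta_slash_S hσ hS)
      (hL.weightedTheta_slash_T P k)]
    exact isBoundedAtImInfty_of_hasSum_qExpansion one_pos (hL.hasSum_weightedTheta hP)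

theorem coeff_thetaModularForm (hL : IsEvenUnimodular L) (hP : PolyBounded P) {k : ℕ} {σ : ℂ}
    (hσ : σ * (-I) ^ k = 1) (hS : ∀ z : ℂ, 0 < z.re →
      weightedSum L P (π * (1 / z)) = σ * z ^ k * weightedSum L P (π * z)) (m : ℕ) :
    (qExpansion 1 (thetaModularForm hL hP hσ hS)).coeff m = shellSum L P m :=
  (ModularFormClass.qExpansion_coeff_unique (c := fun m => (shellSum L P m : ℂ))
    (f := thetaModularForm hL hP hσ hS) one_pos one_mem_strictPeriods_SL
    (hL.hasSum_weightedTheta hP) m).symm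

end WeightedTheta

end GaussianCore

end

noncomputable section

namespace GaussianCore

open Complex ModularForm
open UpperHalfPlane hiding I
open scoped Real

/-! ### Spaces of level one cusp forms of small weight -/

section LevelOneVanishing

/-- Below weight $12$ there are no cusp forms; in weight $14$, division by the discriminant leads to
weight $2$, where every form is zero. -/
theorem levelOne_eq_zero_of_weight {k : ℤ} (hk : k < 12 ∨ k = 14) (g : ModularForm 𝒮ℒ k)
    (h0 : (qExpansion 1 g).coeff 0 = 0) : g = 0 := by
  have h1 : toCuspForm g h0 = 0 := by
    rcases hk with hk | rfl
    · exact rank_zero_iff_forall_zero.1 (CuspForm.rank_eq_zero_of_weight_lt_twelve hk) _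
    · have h2 : CuspForm.discriminantEquiv (toCuspForm g h0) = 0 :=
        rank_zero_iff_forall_zero.1 levelOne_weight_two_rank_zero _
      simpa using h2
  ext z
  exact DFunLike.congr_fun h1 z

/-- Below weight $12$ the form `g` is zero and no normalisation of `f` is needed. For weights from
$12$ to $23$ the Sturm bound is less than $2$: subtracting the multiple of `f` that kills the
coefficient of $q$ leaves zero. -/
theorem coeff_eq_coeff_one_mul {k K : ℤ} (hK : K = k) (hk : k < 24) (g : ModularForm 𝒮ℒ k)
    (h0 : (qExpansion 1 g).coeff 0 = 0) (f : CuspForm 𝒮ℒ K) (hf : 12 ≤ k → cuspCoeff f 1 = 1)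
    (m : ℕ) : (qExpansion 1 g).coeff m = (qExpansion 1 g).coeff 1 * cuspCoeff f m := by
  subst hK
  have hf0 : (qExpansion 1 f).coeff 0 = 0 :=
    CuspFormClass.qExpansion_coeff_zero f one_pos one_mem_strictPeriods_SL
  rcases lt_or_ge K 12 with h12 | h12
  · rw [levelOne_eq_zero_of_weight (Or.inl h12) g h0]
    simp [qExpansion_zero]
  · set F : ModularForm 𝒮ℒ K := CuspForm.toModularFormₗ f
    have hF (j : ℕ) : (qExpansion 1 F).coeff j = cuspCoeff f j := rfl
    set b := (qExpansion 1 g).coeff 1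
    have hq : qExpansion 1 (g - b • F : ModularForm 𝒮ℒ K) =
        qExpansion 1 g - b • qExpansion 1 F :=
      (ModularForm.qExpansion_sub one_pos one_mem_strictPeriods_SL g (b • F)).trans
        (congrArg (qExpansion 1 g - ·)
          (ModularForm.qExpansion_smul one_pos one_mem_strictPeriods_SL b F))
    have hz : g - b • F = 0 := by
      refine sturm_bound_levelOne ?_
      refine lt_of_lt_of_le ?_ (PowerSeries.nat_le_order _ 2 fun i hi => ?_)
      · have : K.toNat / 12 < 2 := by omega
        exact_mod_cast this
      · rw [hq]
        interval_cases i
        · rw [map_sub, PowerSeries.coeff_smul, hF, h0, cuspCoeff, hf0, smul_zero, sub_zero]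
        · rw [map_sub, PowerSeries.coeff_smul, hF, hf h12, smul_eq_mul, mul_one, sub_self]
    have h1 := congrArg (fun p : PowerSeries ℂ => p.coeff m) hq
    rw [hz] at h1
    simp only [map_sub, PowerSeries.coeff_smul, hF, smul_eq_mul] at h1
    have h2 : qExpansion 1 ((0 : ModularForm 𝒮ℒ K) : ℍ → ℂ) = 0 := qExpansion_zero 1
    rw [h2, map_zero] at h1
    exact (sub_eq_zero.1 h1.symm)

end LevelOneVanishing

/-! ### Harmonic quadratic weights -/

section QuadraticWeights

variable {n : ℕ}

theorem half_pow_eq (z : ℂ) {k : ℕ} (hn : n = 2 * k) :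
    ((1 / z) ^ (1 / 2 : ℂ)) ^ n = (1 / z) ^ k := by
  have := cpow_nat_inv_pow (1 / z) two_ne_zero
  rw [hn, pow_mul]
  congr 1
  rw [one_div (2 : ℂ)]
  exact_mod_cast this

theorem polyBounded_realDiagForm (e : OrthonormalBasis (Fin n) ℝ (E n)) (d : Fin n → ℝ) :
    PolyBounded (realDiagForm e d) :=
  ⟨_, 2, abs_realDiagForm_le e (abs_le_absBound d)⟩

theorem polyBounded_realDiagForm_sq (e : OrthonormalBasis (Fin n) ℝ (E n)) (d : Fin n → ℝ) :
    PolyBounded fun x => realDiagForm e d x ^ 2 :=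
  ⟨absBound d ^ 2, 4, fun x => by
    rw [abs_pow, show absBound d ^ 2 * ‖x‖ ^ 4 = (absBound d * ‖x‖ ^ 2) ^ 2 by ring]
    gcongr
    exact abs_realDiagForm_le e (abs_le_absBound d) x⟩

theorem polyBounded_norm_pow (j : ℕ) : PolyBounded fun x : E n => ‖x‖ ^ j :=
  ⟨1, j, fun x => by rw [abs_of_nonneg (by positivity), one_mul]⟩

variable {L : Submodule ℤ (E n)}

theorem deformSumDeriv_zero (e : OrthonormalBasis (Fin n) ℝ (E n)) (d : Fin n → ℝ) (w : ℂ) :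
    deformSumDeriv L e d w 0 = -(w * weightedSum L (realDiagForm e d) w) := by
  rw [deformSumDeriv, weightedSum, ← tsum_mul_left, ← tsum_neg]
  refine tsum_congr fun x => ?_
  simp only [expForm_zero]
  rw [show (1 : Fin n → ℝ) = fun _ => 1 from rfl, realDiagForm_const, one_mul, ofReal_pow]
  ring

theorem deformSum_zero (e : OrthonormalBasis (Fin n) ℝ (E n)) (d : Fin n → ℝ) (w : ℂ) :
    deformSum L e d w 0 = weightedSum L (fun _ => 1) w := by
  refine tsum_congr fun x => ?_
  simp only [expForm_zero]
  rw [show (1 : Fin n → ℝ) = fun _ => 1 from rfl, realDiagForm_const, one_mul, ofReal_pow,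
    ofReal_one, one_mul]

variable [DiscreteTopology L]

theorem deformSumDeriv2_zero (e : OrthonormalBasis (Fin n) ℝ (E n)) (d : Fin n → ℝ) {w : ℂ}
    (hw : 0 < w.re) : deformSumDeriv2 L e d w 0 =
      w ^ 2 * weightedSum L (fun x => realDiagForm e d x ^ 2) w -
        w * weightedSum L (realDiagForm e fun i => d i * d i) w := by
  rw [weightedSum, weightedSum, ← tsum_mul_left, ← tsum_mul_left, ← Summable.tsum_sub]
  · refine tsum_congr fun x => ?_
    simp only [expForm_zero]
    rw [show (1 : Fin n → ℝ) = fun _ => 1 from rfl, realDiagForm_const, one_mul, ofReal_pow,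
      ofReal_pow]
    ring
  · exact ((polyBounded_realDiagForm_sq e d).summable L hw).mul_left _
  · exact ((polyBounded_realDiagForm e _).summable L hw).mul_left _

variable [IsZLattice ℝ L]

/-- The first derivative of the inversion formula at $s=0$. Differentiation brings down $\pi z$ on
one side and $\pi/z$ on the other, which raises the weight by $2$. -/
theorem weightedSum_realDiagForm_inversion (hL : IsEvenUnimodular L)
    (e : OrthonormalBasis (Fin n) ℝ (E n)) {d : Fin n → ℝ} (hd : ∑ i, d i = 0) {k : ℕ}
    (hn : n = 2 * k) {z : ℂ} (hz : 0 < z.re) :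
    weightedSum L (realDiagForm e d) (π * (1 / z)) =
      -1 * z ^ (k + 2) * weightedSum L (realDiagForm e d) (π * z) := by
  have hz0 : z ≠ 0 := fun h => by simp [h] at hz
  have hpi : (π : ℂ) ≠ 0 := ofReal_ne_zero.2 Real.pi_ne_zero
  have h := deformSumDeriv_inversion hL.unimodular e d hz (s := 0) (by simp)
  simp only [hd, ofReal_zero, zero_div, mul_zero, Complex.exp_zero, one_mul, zero_mul, add_zero,
    neg_zero, deformSumDeriv_zero] at h
  rw [half_pow_eq z hn, show (1 / z) ^ k = 1 / z ^ k by rw [one_div, one_div, inv_pow]] at h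
  set W := weightedSum L (realDiagForm e d) (π * z)
  set W' := weightedSum L (realDiagForm e d) (π * (1 / z))
  field_simp at h
  rw [pow_add]
  linear_combination -h

/-- The harmonic quadratic forms have vanishing sums over all shells. -/
def QuadraticDesign (L : Submodule ℤ (E n)) : Prop :=
  ∀ (e : OrthonormalBasis (Fin n) ℝ (E n)) (d : Fin n → ℝ), ∑ i, d i = 0 →
    ∀ m : ℕ, shellSum L (realDiagForm e d) m = 0

/-- As $8\mid n$, the weight $n/2+2$ is one of $2,6,10,14$, and the constant term vanishes. -/
theorem IsEvenUnimodular.quadraticDesign_of_le (hL : IsEvenUnimodular L) (hn : n ≤ 24) :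
    QuadraticDesign L := by
  intro e d hd
  obtain ⟨j, hj⟩ := hL.eight_dvd
  have hσ : (-1 : ℂ) * (-I) ^ (4 * j + 2) = 1 := by
    rw [pow_add, pow_mul, Even.neg_pow (by decide), I_pow_four, one_pow, neg_sq, I_sq]
    norm_num
  have hS := fun (z : ℂ) (hz : 0 < z.re) =>
    weightedSum_realDiagForm_inversion hL e hd (k := 4 * j) (by omega) hz
  have hP := polyBounded_realDiagForm e d
  have h0 : shellSum L (realDiagForm e d) 0 = 0 := by
    rw [shellSum_eq_sum]
    refine Finset.sum_eq_zero fun x hx => ?_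
    rw [Set.Finite.mem_toFinset, mem_shell_iff] at hx
    have hx0 : x = 0 := by simpa using hx.2
    simp [hx0, realDiagForm]
  have hg := levelOne_eq_zero_of_weight (by push_cast; omega) (thetaModularForm hL hP hσ hS)
    (by rw [coeff_thetaModularForm, h0, ofReal_zero])
  intro m
  have h1 := coeff_thetaModularForm hL hP hσ hS m
  rw [hg] at h1
  have h2 : qExpansion 1 ((0 : ModularForm 𝒮ℒ ((4 * j + 2 : ℕ) : ℤ)) : ℍ → ℂ) = 0 :=
    qExpansion_zero 1
  rw [h2, map_zero] at h1
  exact_mod_cast h1.symm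

end QuadraticWeights

/-! ### Squares of quadratic forms as weights -/

section QuarticWeights

variable {n : ℕ} {L : Submodule ℤ (E n)} [DiscreteTopology L]

/-- Subtracting the mean of `d` leaves a trace-zero form, whose shell sum vanishes. -/
theorem QuadraticDesign.shellSum_eq (hD : QuadraticDesign L) (hn : n ≠ 0)
    (e : OrthonormalBasis (Fin n) ℝ (E n)) (d : Fin n → ℝ) (m : ℕ) :
    shellSum L (realDiagForm e d) m = (∑ i, d i) / n * shellSum L (fun x => ‖x‖ ^ 2) m := by
  have hn' : (n : ℝ) ≠ 0 := Nat.cast_ne_zero.2 hn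
  have h := hD e (fun i => d i - (∑ i, d i) / n) (by
    rw [Finset.sum_sub_distrib, Finset.sum_const, Finset.card_univ, Fintype.card_fin, nsmul_eq_mul]
    field_simp
    ring) m
  rw [shellSum_eq_sum] at h ⊢
  rw [shellSum_eq_sum, Finset.mul_sum, ← sub_eq_zero, ← Finset.sum_sub_distrib, ← h]
  refine Finset.sum_congr rfl fun x _ => ?_
  rw [← realDiagForm_const e, realDiagForm, realDiagForm, realDiagForm, ← Finset.sum_sub_distrib]
  exact Finset.sum_congr rfl fun i _ => by ring

theorem QuadraticDesign.weightedSum_eq (hL : IsEvenUnimodular L) (hD : QuadraticDesign L)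
    (hn : n ≠ 0) (e : OrthonormalBasis (Fin n) ℝ (E n)) (d : Fin n → ℝ) {w : ℂ} (hw : 0 < w.re) :
    weightedSum L (realDiagForm e d) w =
      ((∑ i, d i) / n : ℝ) * weightedSum L (fun x => ‖x‖ ^ 2) w := by
  have h1 := hL.hasSum_shellSum (polyBounded_realDiagForm e d) hw
  have h2 := (hL.hasSum_shellSum (polyBounded_norm_pow 2) hw).mul_left (((∑ i, d i) / n : ℝ) : ℂ)
  refine h1.unique (Eq.mpr (congrArg (fun g => HasSum g _) (funext fun m => ?_)) h2)
  rw [hD.shellSum_eq hn, ofReal_mul]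
  ring

/-- The harmonic projection of the square of a trace zero quadratic form. -/
def quarticWeight (e : OrthonormalBasis (Fin n) ℝ (E n)) (d : Fin n → ℝ) (x : E n) : ℝ :=
  realDiagForm e d x ^ 2 - 2 * (∑ i, d i * d i) / (n * (n + 2)) * ‖x‖ ^ 4

theorem polyBounded_quarticWeight (e : OrthonormalBasis (Fin n) ℝ (E n)) (d : Fin n → ℝ) :
    PolyBounded (quarticWeight e d) := by
  refine ⟨absBound d ^ 2 + |2 * (∑ i, d i * d i) / (n * (n + 2))|, 4, fun x => ?_⟩
  refine (abs_sub _ _).trans ?_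
  rw [add_mul, abs_mul, abs_pow, abs_of_nonneg (by positivity : 0 ≤ ‖x‖ ^ 4),
    show absBound d ^ 2 * ‖x‖ ^ 4 = (absBound d * ‖x‖ ^ 2) ^ 2 by ring]
  gcongr
  exact abs_realDiagForm_le e (abs_le_absBound d) x

theorem weightedSum_quarticWeight (e : OrthonormalBasis (Fin n) ℝ (E n)) (d : Fin n → ℝ) {w : ℂ}
    (hw : 0 < w.re) : weightedSum L (quarticWeight e d) w =
      weightedSum L (fun x => realDiagForm e d x ^ 2) w -
        (2 * (∑ i, d i * d i) / (n * (n + 2)) : ℝ) * weightedSum L (fun x => ‖x‖ ^ 4) w := by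
  rw [weightedSum, weightedSum, weightedSum, ← tsum_mul_left, ← Summable.tsum_sub]
  · refine tsum_congr fun x => ?_
    rw [quarticWeight]
    push_cast
    ring
  · exact (polyBounded_realDiagForm_sq e d).summable L hw
  · exact ((polyBounded_norm_pow 4).summable L hw).mul_left _

theorem shellSum_quarticWeight_zero (e : OrthonormalBasis (Fin n) ℝ (E n)) (d : Fin n → ℝ) :
    shellSum L (quarticWeight e d) 0 = 0 := by
  rw [shellSum_eq_sum]
  refine Finset.sum_eq_zero fun x hx => ?_
  rw [Set.Finite.mem_toFinset, mem_shell_iff] at hx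
  have hx0 : x = 0 := by simpa using hx.2
  simp [hx0, quarticWeight, realDiagForm]

variable [IsZLattice ℝ L]

/-- The second-derivative law for `d` contains $\|x\|^2$-sums, through the design property. The laws
for the constant family $1$ (second and first derivative) are used to eliminate them. -/
theorem weightedSum_quarticWeight_inversion (hL : IsEvenUnimodular L) (hD : QuadraticDesign L)
    (hn0 : n ≠ 0) (e : OrthonormalBasis (Fin n) ℝ (E n)) {d : Fin n → ℝ} (hd : ∑ i, d i = 0) {k : ℕ}
    (hn : n = 2 * k) {z : ℂ} (hz : 0 < z.re) :
    weightedSum L (quarticWeight e d) (π * (1 / z)) =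
      1 * z ^ (k + 4) * weightedSum L (quarticWeight e d) (π * z) := by
  have hz0 : z ≠ 0 := fun h => by simp [h] at hz
  have hpi : (π : ℂ) ≠ 0 := ofReal_ne_zero.2 Real.pi_ne_zero
  have hw1 : 0 < ((π : ℂ) * z).re := re_pi_mul_pos hz
  have hw2 : 0 < ((π : ℂ) * (1 / z)).re := by
    refine re_pi_mul_pos ?_
    rw [one_div, inv_re]
    have : 0 < normSq z := normSq_pos.2 hz0
    positivity
  have hone : realDiagForm e (fun _ => 1) = fun x => ‖x‖ ^ 2 := funext fun x => by
    rw [realDiagForm_const, one_mul]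
  have hX := deformSumDeriv2_inversion hL.unimodular e d hz
  have hY := deformSumDeriv2_inversion hL.unimodular e (fun _ => 1) hz
  have hY1 := deformSumDeriv_inversion hL.unimodular e (fun _ => 1) hz (s := 0) (by simp)
  have hfour : (fun x : E n => (‖x‖ ^ 2) ^ 2) = fun x => ‖x‖ ^ 4 := funext fun x => by ring
  rw [deformSumDeriv2_zero e d hw1, deformSumDeriv2_zero e d hw2, hD.weightedSum_eq hL hn0 e _ hw1,
    hD.weightedSum_eq hL hn0 e _ hw2] at hX
  rw [deformSumDeriv2_zero e _ hw1, deformSumDeriv2_zero e _ hw2] at hY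
  rw [weightedSum_quarticWeight e d hw1, weightedSum_quarticWeight e d hw2]
  simp only [hd, ofReal_zero, zero_mul, ne_eq, OfNat.ofNat_ne_zero, not_false_eq_true, zero_pow,
    zero_div, add_zero] at hX
  simp only [mul_one, hone, hfour, Finset.sum_const, Finset.card_univ, Fintype.card_fin, nsmul_eq_mul,
    deformSumDeriv_zero, deformSum_zero, ofReal_natCast] at hY
  simp only [ofReal_zero, zero_mul, Complex.exp_zero, one_mul, neg_zero, deformSumDeriv_zero,
    deformSum_zero, hone, Finset.sum_const, Finset.card_univ, Fintype.card_fin, nsmul_eq_mul,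
    ofReal_natCast, mul_one] at hY1
  rw [half_pow_eq z hn] at hX hY hY1
  set T : ℝ := ∑ i, d i * d i
  set W := weightedSum L (fun x => realDiagForm e d x ^ 2) (π * z)
  set W' := weightedSum L (fun x => realDiagForm e d x ^ 2) (π * (1 / z))
  set N2 := weightedSum L (fun x => ‖x‖ ^ 2) (π * z)
  set N2' := weightedSum L (fun x => ‖x‖ ^ 2) (π * (1 / z))
  set N4 := weightedSum L (fun x => ‖x‖ ^ 4) (π * z)
  set N4' := weightedSum L (fun x => ‖x‖ ^ 4) (π * (1 / z))
  have hnC : (n : ℂ) ≠ 0 := Nat.cast_ne_zero.2 hn0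
  have hnC2 : (n : ℂ) + 2 ≠ 0 := by exact_mod_cast (by omega : n + 2 ≠ 0)
  set c : ℂ := ((2 * T / (n * (n + 2)) : ℝ) : ℂ) with hc
  have hTc : ((T / n : ℝ) : ℂ) = c * (n + 2) / 2 := by
    rw [hc]
    push_cast
    field_simp
  rw [hTc] at hX
  -- The multiple $-c$ matches the quartic terms; $cn/2$ cancels the unweighted theta sums. The
  -- $\|x\|^2$-sums then cancel because $T/n=c(n+2)/2$, which is where $2/(n(n+2))$ comes from.
  have key : (π * z) ^ 2 * (W - c * N4) = (1 / z) ^ k * ((π * (1 / z)) ^ 2 * (W' - c * N4')) := by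
    linear_combination hX - c * hY + c * n / 2 * hY1
  rw [show (1 / z) ^ k = 1 / z ^ k by rw [one_div, one_div, inv_pow]] at key
  field_simp at key
  linear_combination -key

/-- The weight $n/2+4$ is one of $8,12,16,20$, where cusp forms are determined by their first
coefficient. -/
theorem shellSum_quarticWeight_eq (hL : IsEvenUnimodular L) (hD : QuadraticDesign L)
    (hn0 : n ≠ 0) (hn : n ≤ 32) (f : CuspForm 𝒮ℒ ((n : ℤ) / 2 + 4))
    (hf : 8 < n → cuspCoeff f 1 = 1) (e : OrthonormalBasis (Fin n) ℝ (E n)) {d : Fin n → ℝ}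
    (hd : ∑ i, d i = 0) (m : ℕ) : (shellSum L (quarticWeight e d) m : ℂ) =
      shellSum L (quarticWeight e d) 1 * cuspCoeff f m := by
  obtain ⟨j, hj⟩ := hL.eight_dvd
  have hσ : (1 : ℂ) * (-I) ^ (4 * j + 4) = 1 := by
    rw [← mul_add_one, pow_mul, Even.neg_pow (by decide), I_pow_four, one_pow, one_mul]
  have hS := fun (z : ℂ) (hz : 0 < z.re) =>
    weightedSum_quarticWeight_inversion hL hD hn0 e hd (k := 4 * j) (by omega) hz
  have hP := polyBounded_quarticWeight e d
  have h := coeff_eq_coeff_one_mul (by push_cast; omega) (by push_cast; omega)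
    (thetaModularForm hL hP hσ hS)
    (by rw [coeff_thetaModularForm, shellSum_quarticWeight_zero, ofReal_zero]) f
    (fun h => hf (by push_cast at h; omega)) m
  rwa [coeff_thetaModularForm, coeff_thetaModularForm] at h

end QuarticWeights

end GaussianCore

end

noncomputable section

namespace GaussianCore

open MeasureTheory
open scoped Pointwise

/-! ### Sphere averages and the design hypothesis -/

section SphereSymmetry

variable {n : ℕ}

/-- The map of the unit sphere induced by a linear isometry. -/
def sphereMap (φ : E n ≃ₗᵢ[ℝ] E n) (u : Metric.sphere (0 : E n) 1) : Metric.sphere (0 : E n) 1 :=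
  ⟨φ u, by simp⟩

theorem continuous_sphereMap (φ : E n ≃ₗᵢ[ℝ] E n) : Continuous (sphereMap φ) :=
  (φ.continuous.comp continuous_subtype_val).subtype_mk _

/-- The sphere measure is defined through the volume of the cone over a set, and linear isometries
preserve volume and commute with forming cones. -/
theorem measurePreserving_sphereMap (φ : E n ≃ₗᵢ[ℝ] E n) :
    MeasurePreserving (sphereMap φ) (volume : Measure (E n)).toSphere
      (volume : Measure (E n)).toSphere := by
  refine ⟨(continuous_sphereMap φ).measurable, Measure.ext fun s hs => ?_⟩
  rw [Measure.map_apply (continuous_sphereMap φ).measurable hs, Measure.toSphere_apply' _ hs,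
    Measure.toSphere_apply' _ ((continuous_sphereMap φ).measurable hs)]
  congr 1
  rw [← φ.measurePreserving.measure_preimage_equiv (f := φ.toMeasurableEquiv)
    (Set.Ioo (0 : ℝ) 1 • (Subtype.val '' s))]
  congr 1
  ext x
  simp only [Set.mem_smul, Set.mem_image, Set.mem_preimage, Subtype.exists]
  constructor
  · rintro ⟨r, hr, _, ⟨u, hu, hus, rfl⟩, rfl⟩
    exact ⟨r, hr, φ u, ⟨φ u, (sphereMap φ ⟨u, hu⟩).2, hus, rfl⟩, (map_smul φ r u).symm⟩
  · rintro ⟨r, hr, _, ⟨v, hv, hvs, rfl⟩, hrv⟩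
    refine ⟨r, hr, φ.symm v, ⟨φ.symm v, by simpa using hv, ?_, rfl⟩, ?_⟩
    · have : sphereMap φ ⟨φ.symm v, by simpa using hv⟩ = ⟨v, hv⟩ := Subtype.ext (by simp [sphereMap])
      rwa [this]
    · apply φ.injective
      rw [map_smul, φ.apply_symm_apply]
      exact hrv

/-- The isometry exchanging two basis vectors preserves the sphere measure. -/
theorem integral_sphere_inner_sq_eq (e : OrthonormalBasis (Fin n) ℝ (E n)) (i j : Fin n) :
    ∫ u : Metric.sphere (0 : E n) 1, inner ℝ (e i) (u : E n) ^ 2 ∂(volume : Measure (E n)).toSphere =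
      ∫ u : Metric.sphere (0 : E n) 1, inner ℝ (e j) (u : E n) ^ 2
        ∂(volume : Measure (E n)).toSphere := by
  let φ : E n ≃ₗᵢ[ℝ] E n := e.equiv e (Equiv.swap i j)
  have h := (measurePreserving_sphereMap φ).integral_comp
    (Homeomorph.measurableEmbedding
      { toFun := sphereMap φ
        invFun := sphereMap φ.symm
        left_inv := fun u => Subtype.ext (by simp [sphereMap])
        right_inv := fun u => Subtype.ext (by simp [sphereMap])
        continuous_toFun := continuous_sphereMap φ
        continuous_invFun := continuous_sphereMap φ.symm })
    (fun u => inner ℝ (e j) (u : E n) ^ 2)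
  rw [← h]
  refine integral_congr_ae (Filter.Eventually.of_forall fun u => ?_)
  have h1 : φ (e i) = e j := by simp [φ]
  simp only [sphereMap]
  rw [← h1, φ.inner_map_map]

theorem integral_sphere_realDiagForm (e : OrthonormalBasis (Fin n) ℝ (E n)) {d : Fin n → ℝ}
    (hd : ∑ i, d i = 0) :
    ∫ u : Metric.sphere (0 : E n) 1, realDiagForm e d (u : E n) ∂(volume : Measure (E n)).toSphere =
      0 := by
  simp only [realDiagForm]
  rw [integral_finsetSum]
  · simp_rw [integral_const_mul]
    rcases isEmpty_or_nonempty (Fin n) with h | ⟨⟨i0⟩⟩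
    · simp
    · rw [Finset.sum_congr rfl fun i _ => by rw [integral_sphere_inner_sq_eq e i i0],
        ← Finset.sum_mul, hd, zero_mul]
  · intro i _
    have hc : Continuous fun u : Metric.sphere (0 : E n) 1 => d i * inner ℝ (e i) (u : E n) ^ 2 := by
      fun_prop
    have hcomp : CompactSpace (Metric.sphere (0 : E n) 1) :=
      isCompact_iff_compactSpace.1 (isCompact_sphere 0 1)
    exact hc.integrable_of_hasCompactSupport (HasCompactSupport.of_compactSpace _)

/-- The quadratic form `realDiagForm e d` as a polynomial in the standard coordinates. -/
def diagPoly (e : OrthonormalBasis (Fin n) ℝ (E n)) (d : Fin n → ℝ) : MvPolynomial (Fin n) ℝ :=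
  ∑ i, MvPolynomial.C (d i) * (∑ j, MvPolynomial.C ((e i).ofLp j) * MvPolynomial.X j) ^ 2

theorem eval_diagPoly (e : OrthonormalBasis (Fin n) ℝ (E n)) (d : Fin n → ℝ) (x : E n) :
    MvPolynomial.eval x.ofLp (diagPoly e d) = realDiagForm e d x := by
  simp [diagPoly, realDiagForm, PiLp.inner_apply, mul_comm]

theorem totalDegree_diagPoly_le (e : OrthonormalBasis (Fin n) ℝ (E n)) (d : Fin n → ℝ) :
    (diagPoly e d).totalDegree ≤ 2 := by
  refine MvPolynomial.totalDegree_finsetSum_le fun i _ => ?_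
  refine (MvPolynomial.totalDegree_mul _ _).trans ?_
  rw [MvPolynomial.totalDegree_C, zero_add]
  refine (MvPolynomial.totalDegree_pow _ _).trans ?_
  have : (∑ j, MvPolynomial.C ((e i).ofLp j) * MvPolynomial.X j :
      MvPolynomial (Fin n) ℝ).totalDegree ≤ 1 := by
    refine MvPolynomial.totalDegree_finsetSum_le fun j _ => ?_
    refine (MvPolynomial.totalDegree_mul _ _).trans ?_
    simp
  omega

theorem realDiagForm_smul (e : OrthonormalBasis (Fin n) ℝ (E n)) (d : Fin n → ℝ) (r : ℝ) (x : E n) :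
    realDiagForm e d (r • x) = r ^ 2 * realDiagForm e d x := by
  simp only [realDiagForm, inner_smul_right, Finset.mul_sum]
  exact Finset.sum_congr rfl fun i _ => by ring

/-- A trace-zero quadratic form has mean zero on the sphere, hence on each nonempty shell of
positive radius; the shell of radius $0$ contributes nothing. -/
theorem AllShellsDesigns.quadraticDesign {L : Submodule ℤ (E n)} [DiscreteTopology L]
    (h : AllShellsDesigns 2 L) : QuadraticDesign L := by
  intro e d hd m
  rcases (shell L (2 * (m : ℝ))).eq_empty_or_nonempty with hemp | hne
  · rw [shellSum, hemp]
    simp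
  rcases Nat.eq_zero_or_pos m with rfl | hm
  · rw [shellSum_eq_sum]
    refine Finset.sum_eq_zero fun x hx => ?_
    rw [Set.Finite.mem_toFinset, mem_shell_iff] at hx
    have hx0 : x = 0 := by simpa using hx.2
    simp [hx0, realDiagForm]
  have hm' : (0 : ℝ) < 2 * m := by positivity
  have hsq : √(2 * (m : ℝ)) ^ 2 = 2 * (m : ℝ) := Real.sq_sqrt hm'.le
  have h1 := (h (√(2 * (m : ℝ))) (Real.sqrt_pos.2 hm') (by rwa [hsq])).2.2 (diagPoly e d)
    (totalDegree_diagPoly_le e d)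
  simp only [eval_diagPoly, realDiagForm_smul, hsq] at h1
  rw [average_eq, integral_const_mul, integral_sphere_realDiagForm e hd, mul_zero, smul_zero,
    eq_comm, div_eq_zero_iff] at h1
  rcases h1 with h1 | h1
  · exact h1
  · rw [Nat.cast_eq_zero, Set.ncard_eq_zero (shell_finite L _)] at h1
    exact absurd h1 hne.ne_empty

end SphereSymmetry

theorem IsEvenUnimodular.quadraticDesign {n : ℕ} {L : Submodule ℤ (E n)} [DiscreteTopology L]
    [IsZLattice ℝ L] (hL : IsEvenUnimodular L) (hn : n ≤ 32)
    (h32 : n = 32 → AllShellsDesigns 2 L) : QuadraticDesign L := by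
  rcases eq_or_ne n 32 with h | h
  · exact (h32 h).quadraticDesign
  · refine hL.quadraticDesign_of_le ?_
    have := hL.eight_dvd
    omega

end GaussianCore

end

noncomputable section

namespace GaussianCore

/-! ### Diagonalisation of the tangent direction -/

section SpectralForm

variable {n : ℕ} {H : Matrix (Fin n) (Fin n) ℝ}

theorem isHermitian_of_isSymm (hH : H.IsSymm) : H.IsHermitian := by
  rw [Matrix.IsHermitian, Matrix.conjTranspose_eq_transpose_of_trivial]
  exact hH

theorem quadVal_eq_inner (H : Matrix (Fin n) (Fin n) ℝ) (x : E n) :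
    quadVal H x = inner ℝ (Matrix.toEuclideanLin H x) x := by
  simp [quadVal, Matrix.toLpLin_apply, PiLp.inner_apply, dotProduct]

theorem inner_eigenvectorBasis_toEuclideanLin (hH : H.IsHermitian) (i : Fin n) (x : E n) :
    inner ℝ (hH.eigenvectorBasis i) (Matrix.toEuclideanLin H x) =
      hH.eigenvalues i * inner ℝ (hH.eigenvectorBasis i) x := by
  have h1 : Matrix.toEuclideanLin H (hH.eigenvectorBasis i) =
      hH.eigenvalues i • hH.eigenvectorBasis i := by
    rw [Matrix.toLpLin_apply, hH.mulVec_eigenvectorBasis]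
    rfl
  rw [← (Matrix.isSymmetric_toEuclideanLin_iff.2 hH), h1, real_inner_smul_left]

theorem quadVal_eq_realDiagForm (hH : H.IsHermitian) (x : E n) :
    quadVal H x = realDiagForm hH.eigenvectorBasis hH.eigenvalues x := by
  rw [quadVal_eq_inner, ← hH.eigenvectorBasis.sum_inner_mul_inner, realDiagForm]
  refine Finset.sum_congr rfl fun i _ => ?_
  rw [real_inner_comm, inner_eigenvectorBasis_toEuclideanLin]
  ring

theorem trace_eq_sum (hH : H.IsHermitian) : H.trace = ∑ i, hH.eigenvalues i := by
  simpa using hH.trace_eq_sum_eigenvalues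

theorem spectral_conj (hH : H.IsHermitian) :
    H = (hH.eigenvectorUnitary : Matrix (Fin n) (Fin n) ℝ) * Matrix.diagonal hH.eigenvalues *
      (hH.eigenvectorUnitary : Matrix (Fin n) (Fin n) ℝ)⁻¹ := by
  have h1 := hH.spectral_theorem
  have h2 : (hH.eigenvectorUnitary : Matrix (Fin n) (Fin n) ℝ)⁻¹ =
      star (hH.eigenvectorUnitary : Matrix (Fin n) (Fin n) ℝ) :=
    Matrix.inv_eq_left_inv (Unitary.coe_star_mul_self hH.eigenvectorUnitary)
  rw [h2]
  rw [Unitary.conjStarAlgAut_apply] at h1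
  exact h1

theorem isUnit_eigenvectorUnitary (hH : H.IsHermitian) :
    IsUnit (hH.eigenvectorUnitary : Matrix (Fin n) (Fin n) ℝ) :=
  (Unitary.toUnits hH.eigenvectorUnitary).isUnit

theorem trace_mul_self_eq_sum (hH : H.IsHermitian) :
    (H * H).trace = ∑ i, hH.eigenvalues i * hH.eigenvalues i := by
  have hU := (Matrix.isUnit_iff_isUnit_det _).1 (isUnit_eigenvectorUnitary hH)
  set U := (hH.eigenvectorUnitary : Matrix (Fin n) (Fin n) ℝ)
  set D := Matrix.diagonal hH.eigenvalues
  have h1 : H * H = U * (D * D) * U⁻¹ := by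
    conv_lhs => rw [spectral_conj hH]
    simp only [Matrix.mul_assoc]
    rw [Matrix.nonsing_inv_mul_cancel_left _ _ hU]
  rw [h1, Matrix.trace_mul_comm, Matrix.nonsing_inv_mul_cancel_left _ _ hU,
    Matrix.diagonal_mul_diagonal, Matrix.trace_diagonal]

theorem toEuclideanLin_exp_eigenvectorBasis (hH : H.IsHermitian) (c : ℝ) (i : Fin n) :
    Matrix.toEuclideanLin (NormedSpace.exp (c • H)) (hH.eigenvectorBasis i) =
      Real.exp (c * hH.eigenvalues i) • hH.eigenvectorBasis i := by
  have hU' := isUnit_eigenvectorUnitary hH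
  have hU := (Matrix.isUnit_iff_isUnit_det _).1 hU'
  have hcol : (hH.eigenvectorBasis i).ofLp =
      (hH.eigenvectorUnitary : Matrix (Fin n) (Fin n) ℝ) *ᵥ Pi.single i 1 := by
    funext j
    simp
  have hexp : NormedSpace.exp (c • H) =
      (hH.eigenvectorUnitary : Matrix (Fin n) (Fin n) ℝ) *
        Matrix.diagonal (fun i => Real.exp (c * hH.eigenvalues i)) *
        (hH.eigenvectorUnitary : Matrix (Fin n) (Fin n) ℝ)⁻¹ := by
    conv_lhs => rw [spectral_conj hH]
    rw [← Matrix.smul_mul, ← Matrix.mul_smul, ← Matrix.diagonal_smul, Matrix.exp_conj _ _ hU',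
      Matrix.exp_diagonal]
    congr 3
    funext j
    rw [Pi.coe_exp, ← Real.exp_eq_exp_ℝ]
    rfl
  rw [Matrix.toLpLin_apply]
  refine (WithLp.toLp_injective 2).eq_iff.2 ?_
  change NormedSpace.exp (c • H) *ᵥ (hH.eigenvectorBasis i).ofLp =
    Real.exp (c * hH.eigenvalues i) • (hH.eigenvectorBasis i).ofLp
  rw [hexp, hcol, Matrix.mulVec_mulVec, Matrix.mul_assoc, Matrix.nonsing_inv_mul _ hU,
    Matrix.mul_one, ← Matrix.mulVec_mulVec, Matrix.diagonal_mulVec_single, mul_one,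
    ← Matrix.mulVec_smul]
  congr 1
  simp [← Pi.single_smul]

/-- Along an eigenvector the deformation scales by $e^{td_i/2}$, so squared lengths acquire
$e^{td_i}$. -/
theorem norm_sq_toEuclideanLin_exp (hH : H.IsHermitian) (t : ℝ) (x : E n) :
    ‖Matrix.toEuclideanLin (NormedSpace.exp ((1 / 2 : ℝ) • t • H)) x‖ ^ 2 =
      expForm hH.eigenvectorBasis hH.eigenvalues 1 t x := by
  set e := hH.eigenvectorBasis
  set d := hH.eigenvalues
  have h1 (j : Fin n) :
      inner ℝ (e j) (Matrix.toEuclideanLin (NormedSpace.exp ((1 / 2 : ℝ) • t • H)) x) =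
      Real.exp (t / 2 * d j) * inner ℝ (e j) x := by
    rw [smul_smul]
    conv_lhs => rw [← e.sum_repr' x]
    rw [map_sum, inner_sum, Finset.sum_eq_single j]
    · rw [map_smul, toEuclideanLin_exp_eigenvectorBasis, inner_smul_right, inner_smul_right,
        real_inner_self_eq_norm_sq, e.norm_eq_one]
      simp only [d]
      ring_nf
    · intro i _ hij
      rw [map_smul, toEuclideanLin_exp_eigenvectorBasis, inner_smul_right, inner_smul_right,
        e.orthonormal.2 hij.symm, mul_zero, mul_zero]
    · simp
  rw [← sum_inner_sq e, expForm, realDiagForm]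
  refine Finset.sum_congr rfl fun i _ => ?_
  rw [h1, mul_pow, ← Real.exp_nat_mul, Pi.one_apply, one_mul]
  congr 2
  push_cast
  ring

end SpectralForm

/-! ### The energy as a deformed theta sum -/

section Energy

open Complex

variable {n : ℕ} (L : Submodule ℤ (E n)) {H : Matrix (Fin n) (Fin n) ℝ}

/-- The nonzero vectors of a lattice correspond to those of its deformation. -/
def deformEquiv (hH : H.IsHermitian) (t : ℝ) :
    {x : L // x ≠ 0} ≃ {y : E n // y ∈ deform L (t • H) ∧ y ≠ 0} :=
  have hinj : ∀ x : E n, Matrix.toEuclideanLin (NormedSpace.exp ((1 / 2 : ℝ) • t • H)) x = 0 →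
      x = 0 := fun x hx => by
    have h1 := norm_sq_toEuclideanLin_exp hH t x
    rw [hx, norm_zero, zero_pow two_ne_zero, expForm, realDiagForm, eq_comm,
      Finset.sum_eq_zero_iff_of_nonneg fun i _ => by rw [Pi.one_apply]; positivity] at h1
    rw [← norm_eq_zero, ← sq_eq_zero_iff, ← sum_inner_sq hH.eigenvectorBasis]
    refine Finset.sum_eq_zero fun i hi => ?_
    have h2 := h1 i hi
    rw [Pi.one_apply, one_mul] at h2
    exact (mul_eq_zero.1 h2).resolve_left (Real.exp_pos _).ne'
  Equiv.ofBijective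
    (fun x => ⟨Matrix.toEuclideanLin (NormedSpace.exp ((1 / 2 : ℝ) • t • H)) x.1,
      Submodule.mem_map.2 ⟨x.1, x.1.2, rfl⟩,
      fun h => x.2 (Subtype.ext (hinj _ h))⟩)
    ⟨fun x y h => by
      have h1 := congrArg Subtype.val h
      simp only at h1
      rw [← sub_eq_zero, ← map_sub] at h1
      exact Subtype.ext (Subtype.ext (sub_eq_zero.1 (hinj _ h1))),
    fun y => by
      obtain ⟨y, hy, hy0⟩ := y
      obtain ⟨x, hx, rfl⟩ := Submodule.mem_map.1 hy
      exact ⟨⟨⟨x, hx⟩, fun h => hy0 (by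
        have : x = 0 := congrArg Subtype.val h
        rw [this, map_zero])⟩, rfl⟩⟩

theorem gaussian_deformEquiv (hH : H.IsHermitian) (t α : ℝ) (x : {x : L // x ≠ 0}) :
    gaussian α (‖(deformEquiv L hH t x : E n)‖ ^ 2) =
      Real.exp (-(α * expForm hH.eigenvectorBasis hH.eigenvalues 1 t x)) := by
  rw [gaussian, ← norm_sq_toEuclideanLin_exp hH, neg_mul]
  rfl

/-- The theta sum with weights `P` at a real argument. -/
def realWeightedSum (P : E n → ℝ) (α : ℝ) : ℝ :=
  ∑' x : L, P x * Real.exp (-(α * ‖(x : E n)‖ ^ 2))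

theorem weightedSum_ofReal (P : E n → ℝ) (α : ℝ) :
    weightedSum L P α = realWeightedSum L P α := by
  rw [realWeightedSum, ofReal_tsum]
  refine tsum_congr fun x => ?_
  push_cast
  rfl

variable [DiscreteTopology L]

theorem summable_exp_neg_expForm (e : OrthonormalBasis (Fin n) ℝ (E n)) (d : Fin n → ℝ) {α : ℝ}
    (hα : 0 < α) (t : ℝ) : Summable fun x : L => Real.exp (-(α * expForm e d 1 t x)) := by
  have h := summable_deformSum L e d (w := α) (by simpa using hα) t
  rw [← Complex.summable_ofReal]
  refine h.congr fun x => ?_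
  push_cast
  rfl

theorem summable_gaussian_deform (hH : H.IsHermitian) {α : ℝ} (hα : 0 < α) (t : ℝ) :
    Summable fun x : {x : E n // x ∈ deform L (t • H) ∧ x ≠ 0} =>
      gaussian α (‖(x : E n)‖ ^ 2) := by
  rw [← (deformEquiv L hH t).summable_iff]
  have h := (summable_exp_neg_expForm L hH.eigenvectorBasis hH.eigenvalues hα t).subtype
    {x : L | x ≠ 0}
  exact h.congr fun x => (gaussian_deformEquiv L hH t α x).symm

/-- The theta sum includes the origin, whose term is $1$ for every deformation. -/
theorem energy_deform (hH : H.IsHermitian) {α : ℝ} (hα : 0 < α) (t : ℝ) :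
    energy (gaussian α) (deform L (t • H)) =
      (deformSum L hH.eigenvectorBasis hH.eigenvalues α t).re - 1 := by
  set e := hH.eigenvectorBasis
  set d := hH.eigenvalues
  have h := summable_exp_neg_expForm L e d hα t
  have h1 : energy (gaussian α) (deform L (t • H)) =
      ∑' x : ({0}ᶜ : Set L), Real.exp (-(α * expForm e d 1 t (x : L))) := by
    rw [energy, ← (deformEquiv L hH t).tsum_eq]
    exact tsum_congr fun x => gaussian_deformEquiv L hH t α x
  have h2 : (deformSum L e d α t).re = ∑' x : L, Real.exp (-(α * expForm e d 1 t x)) := by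
    rw [← ofReal_re (∑' x : L, Real.exp (-(α * expForm e d 1 t x))), ofReal_tsum, deformSum]
    congr 1
    refine tsum_congr fun x => ?_
    push_cast
    rfl
  have h3 := h.tsum_subtype_add_tsum_subtype_compl {0}
  rw [h1, h2, ← h3, tsum_singleton (0 : L) fun x : L => Real.exp (-(α * expForm e d 1 t x))]
  simp [expForm, realDiagForm]

theorem energy_deform_eq (hH : H.IsHermitian) {α : ℝ} (hα : 0 < α) :
    (fun t : ℝ => energy (gaussian α) (deform L (t • H))) = fun t =>
      (deformSum L hH.eigenvectorBasis hH.eigenvalues α t).re - 1 :=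
  funext fun t => energy_deform L hH hα t

theorem contDiffAt_energy (hH : H.IsHermitian) {α : ℝ} (hα : 0 < α) :
    ContDiffAt ℝ 2 (fun t : ℝ => energy (gaussian α) (deform L (t • H))) 0 := by
  rw [energy_deform_eq L hH hα]
  have h1 := (contDiffOn_deformSum L hH.eigenvectorBasis hH.eigenvalues (w := α)
    (by simpa using hα)).contDiffAt (isOpen_Ioo.mem_nhds (by simp : (0 : ℝ) ∈ Set.Ioo (-1 : ℝ) 1))
  exact (reCLM.contDiff.contDiffAt.comp 0 h1).sub contDiffAt_const

theorem hessian_eq_re (hH : H.IsHermitian) {α : ℝ} (hα : 0 < α) :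
    hessian α L H = (deformSumDeriv2 L hH.eigenvectorBasis hH.eigenvalues α 0).re / 2 := by
  have hw : 0 < (α : ℂ).re := by simpa using hα
  have h0 : (0 : ℝ) ∈ Set.Ioo (-1 : ℝ) 1 := by simp
  set e := hH.eigenvectorBasis
  set d := hH.eigenvalues
  rw [hessian, energy_deform_eq L hH hα, iteratedDeriv_succ, iteratedDeriv_one]
  congr 1
  have h1 : HasDerivAt (fun t => (deformSumDeriv L e d α t).re) (deformSumDeriv2 L e d α 0).re 0 :=
    reCLM.hasFDerivAt.comp_hasDerivAt 0 (hasDerivAt_deformSumDeriv L e d hw h0)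
  rw [← h1.deriv]
  refine Filter.EventuallyEq.deriv_eq ?_
  filter_upwards [isOpen_Ioo.mem_nhds h0] with s hs
  exact ((reCLM.hasFDerivAt.comp_hasDerivAt s (hasDerivAt_deformSum L e d hw hs)).sub_const 1).deriv

theorem hessian_eq (hH : H.IsHermitian) {α : ℝ} (hα : 0 < α) :
    hessian α L H =
      α ^ 2 / 2 * realWeightedSum L
        (fun x => realDiagForm hH.eigenvectorBasis hH.eigenvalues x ^ 2) α -
      α / 2 * realWeightedSum L
        (realDiagForm hH.eigenvectorBasis fun i => hH.eigenvalues i * hH.eigenvalues i) α := by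
  rw [hessian_eq_re L hH hα, deformSumDeriv2_zero _ _ (by simpa using hα), weightedSum_ofReal,
    weightedSum_ofReal, ← ofReal_pow, ← ofReal_mul, ← ofReal_mul, ← ofReal_sub, ofReal_re]
  ring

end Energy

end GaussianCore

end

noncomputable section

namespace GaussianCore

open Complex ModularForm
open UpperHalfPlane hiding I
open scoped Real

/-! ### The two series of the eigenvalue formula -/

section Series

theorem hasSum_pnat_of_hasSum {M : Type*} [AddCommMonoid M] [TopologicalSpace M] {g : ℕ → M} {a : M}
    (h0 : g 0 = 0) (h : HasSum g a) : HasSum (fun m : ℕ+ => g m) a := by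
  refine (PNat.coe_injective.hasSum_iff fun m hm => ?_).2 h
  rcases Nat.eq_zero_or_pos m with rfl | hm'
  · exact h0
  · exact absurd ⟨⟨m, hm'⟩, rfl⟩ hm

theorem cuspCoeff_zero {k : ℤ} (f : CuspForm 𝒮ℒ k) : cuspCoeff f 0 = 0 :=
  CuspFormClass.qExpansion_coeff_zero f one_pos one_mem_strictPeriods_SL

/-- This is the $q$-expansion at $\tau=i\alpha/\pi$, where $q=e^{-2\alpha}$. -/
theorem summable_cuspCoeff {k : ℤ} (f : CuspForm 𝒮ℒ k) {α : ℝ} (hα : 0 < α) :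
    Summable fun m : ℕ => cuspCoeff f m * cexp (-2 * α * m) := by
  let τ : ℍ := ⟨(α / π : ℝ) * I, by
    rw [im_ofReal_mul, Complex.I_im, mul_one]
    positivity⟩
  refine (ModularForm.hasSum_qExpansion (f := f) one_pos one_mem_strictPeriods_SL τ).summable.congr
    fun m => ?_
  rw [cuspCoeff, Function.Periodic.qParam, ← Complex.exp_nat_mul]
  congr 2
  have hpi : (π : ℂ) ≠ 0 := ofReal_ne_zero.2 Real.pi_ne_zero
  have hτ : (τ : ℂ) = (α / π : ℝ) * I := rfl
  rw [hτ]
  push_cast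
  field_simp
  rw [I_sq]
  ring

/-- The value at `α` of the series in the cusp form coefficients. -/
def cuspSum {k : ℤ} (f : CuspForm 𝒮ℒ k) (α : ℝ) : ℂ :=
  ∑' m : ℕ, cuspCoeff f m * cexp (-2 * α * m)

variable {n : ℕ} {L : Submodule ℤ (E n)}

theorem hasSum_cuspTerm (L : Submodule ℤ (E n)) {k : ℤ} (f : CuspForm 𝒮ℒ k) {α : ℝ} (hα : 0 < α)
    (lam : ℝ) : HasSum (fun m : ℕ+ => cuspTerm L (cuspCoeff f) α lam m)
      (α ^ 2 / 2 * (lam * n * (n + 2) - 8 * thetaCoeff L 1) * cuspSum f α) := by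
  refine hasSum_pnat_of_hasSum (g := cuspTerm L (cuspCoeff f) α lam) ?_ ?_
  · rw [cuspTerm, cuspCoeff_zero]
    ring
  · refine Eq.mpr (congrArg (fun g => HasSum g _) (funext fun m => ?_))
      ((summable_cuspCoeff f hα).hasSum.mul_left
        ((α : ℂ) ^ 2 / 2 * (lam * n * (n + 2) - 8 * thetaCoeff L 1)))
    rw [cuspTerm]
    ring

variable [DiscreteTopology L]

theorem shellSum_norm_pow (L : Submodule ℤ (E n)) [DiscreteTopology L] (j m : ℕ) :
    shellSum L (fun x => ‖x‖ ^ (2 * j)) m = thetaCoeff L m * (2 * (m : ℝ)) ^ j := by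
  rw [shellSum_eq_sum, thetaCoeff, Set.ncard_eq_toFinset_card _ (shell_finite L (2 * (m : ℝ))),
    ← nsmul_eq_mul]
  refine Finset.sum_eq_card_nsmul fun x hx => ?_
  rw [Set.Finite.mem_toFinset, mem_shell_iff] at hx
  rw [pow_mul, hx.2]

theorem IsEvenUnimodular.hasSum_realWeightedSum (hL : IsEvenUnimodular L) {P : E n → ℝ}
    (hP : PolyBounded P) {α : ℝ} (hα : 0 < α) :
    HasSum (fun m : ℕ => shellSum L P m * Real.exp (-2 * α * m)) (realWeightedSum L P α) := by
  rw [← Complex.hasSum_ofReal, ← weightedSum_ofReal]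
  refine Eq.mpr (congrArg (fun g => HasSum g _) (funext fun m => ?_))
    (hL.hasSum_shellSum hP (w := α) (by simpa using hα))
  push_cast
  ring_nf

/-- On $L(2m)$ one has $\|x\|^2=2m$ and $\|x\|^4=4m^2$; the term at $m=0$ is zero. -/
theorem IsEvenUnimodular.hasSum_thetaTerm (hL : IsEvenUnimodular L) {α : ℝ} (hα : 0 < α) :
    HasSum (fun m : ℕ+ => thetaTerm L α m) (α ^ 2 * realWeightedSum L (fun x => ‖x‖ ^ 4) α -
      α * (n / 2 + 1) * realWeightedSum L (fun x => ‖x‖ ^ 2) α) := by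
  refine hasSum_pnat_of_hasSum (g := thetaTerm L α) (by simp [thetaTerm]) ?_
  have h4 := hL.hasSum_realWeightedSum (polyBounded_norm_pow 4) hα
  have h2 := hL.hasSum_realWeightedSum (polyBounded_norm_pow 2) hα
  refine Eq.mpr (congrArg (fun g => HasSum g _) (funext fun m => ?_))
    ((h4.mul_left (α ^ 2)).sub (h2.mul_left (α * (n / 2 + 1))))
  have e4 := shellSum_norm_pow L 2 m
  have e2 := shellSum_norm_pow L 1 m
  norm_num only at e4 e2
  rw [e4, e2, thetaTerm]
  ring

end Series

/-! ### The Hessian in terms of the root form -/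

section HessianFormula

variable {n : ℕ} {L : Submodule ℤ (E n)} {H : Matrix (Fin n) (Fin n) ℝ}

/-- The scalar part of the Hessian. -/
def scalarPart (L : Submodule ℤ (E n)) (α : ℝ) : ℝ :=
  1 / ((n : ℝ) * (n + 2)) * ∑' m : ℕ+, thetaTerm L α m

theorem shellSum_one_sq (hH : H.IsHermitian) :
    shellSum L (fun x => realDiagForm hH.eigenvectorBasis hH.eigenvalues x ^ 2) 1 =
      rootBilin L H H := by
  rw [shellSum, rootBilin, Nat.cast_one, mul_one]
  refine finsum_mem_congr rfl fun x _ => ?_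
  rw [quadVal_eq_realDiagForm hH, sq]

variable [DiscreteTopology L]

theorem shellSum_quarticWeight (e : OrthonormalBasis (Fin n) ℝ (E n)) (d : Fin n → ℝ) (m : ℕ) :
    shellSum L (quarticWeight e d) m = shellSum L (fun x => realDiagForm e d x ^ 2) m -
      2 * (∑ i, d i * d i) / (n * (n + 2)) * shellSum L (fun x => ‖x‖ ^ 4) m := by
  rw [shellSum_eq_sum, shellSum_eq_sum, shellSum_eq_sum, Finset.mul_sum, ← Finset.sum_sub_distrib]
  rfl

/-- The cusp form part of $\sum H[x]^2e^{-\alpha\|x\|^2}$ gives the first summand. Its radial part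
combines with the $H^2[x]$ sum, equal to $\operatorname{Tr}(H^2)/n$ times the $\|x\|^2$ sum, into
the scalar part. The identity is complex because the cusp coefficients are. -/
theorem hessian_formula [IsZLattice ℝ L] (hL : IsEvenUnimodular L) (hD : QuadraticDesign L)
    (hn0 : n ≠ 0) (hn : n ≤ 32) (f : CuspForm 𝒮ℒ ((n : ℤ) / 2 + 4))
    (hf : 8 < n → cuspCoeff f 1 = 1) {α : ℝ} (hα : 0 < α) (hH : IsTangent H) :
    (hessian α L H : ℂ) = α ^ 2 / 2 * cuspSum f α *
        (rootBilin L H H - 8 * thetaCoeff L 1 / (n * (n + 2)) * (H * H).trace : ℝ) +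
      (scalarPart L α * (H * H).trace : ℝ) := by
  have hH' := isHermitian_of_isSymm hH.1
  have hw : 0 < (α : ℂ).re := by simpa using hα
  have hd : ∑ i, hH'.eigenvalues i = 0 := by rw [← trace_eq_sum, hH.2]
  have hnR : (n : ℝ) ≠ 0 := Nat.cast_ne_zero.2 hn0
  have hnR2 : (n : ℝ) + 2 ≠ 0 := by positivity
  rw [hessian_eq L hH' hα, ← shellSum_one_sq hH', trace_mul_self_eq_sum hH', scalarPart,
    (hL.hasSum_thetaTerm hα).tsum_eq]
  set e := hH'.eigenvectorBasis
  set d := hH'.eigenvalues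
  set T := ∑ i, d i * d i with hT
  have hk : realWeightedSum L (realDiagForm e fun i => d i * d i) α =
      T / n * realWeightedSum L (fun x => ‖x‖ ^ 2) α := by
    have := hD.weightedSum_eq hL hn0 e (fun i => d i * d i) hw
    rw [weightedSum_ofReal, weightedSum_ofReal] at this
    exact_mod_cast this
  have hq := weightedSum_quarticWeight (L := L) e d hw
  rw [weightedSum_ofReal L (fun x => realDiagForm e d x ^ 2),
    weightedSum_ofReal L (fun x => ‖x‖ ^ 4)] at hq
  have hq2 : weightedSum L (quarticWeight e d) α =
      shellSum L (quarticWeight e d) 1 * cuspSum f α := by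
    refine (hL.hasSum_shellSum (polyBounded_quarticWeight e d) hw).unique ?_
    refine Eq.mpr (congrArg (fun g => HasSum g _) (funext fun m => ?_))
      ((summable_cuspCoeff f hα).hasSum.mul_left (shellSum L (quarticWeight e d) 1 : ℂ))
    rw [shellSum_quarticWeight_eq hL hD hn0 hn f hf e hd m]
    ring_nf
  -- The constant $8$ is $2\cdot 4$, since $\|x\|^4=4$ on $L(2)$.
  have h1 : shellSum L (quarticWeight e d) 1 =
      shellSum L (fun x => realDiagForm e d x ^ 2) 1 - 8 * thetaCoeff L 1 / (n * (n + 2)) * T := by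
    have e4 := shellSum_norm_pow L 2 1
    norm_num only at e4
    rw [shellSum_quarticWeight, e4, ← hT]
    field_simp
    ring
  rw [hq2, h1, ← hT] at hq
  rw [hk]
  set N4 := realWeightedSum L (fun x => ‖x‖ ^ 4) α
  set N2 := realWeightedSum L (fun x => ‖x‖ ^ 2) α
  set W4 := realWeightedSum L (fun x => realDiagForm e d x ^ 2) α
  have hnC : (n : ℂ) ≠ 0 := Nat.cast_ne_zero.2 hn0
  have hnC2 : (n : ℂ) + 2 ≠ 0 := by exact_mod_cast (by omega : n + 2 ≠ 0)
  have hW : (W4 : ℂ) = (shellSum L (fun x => realDiagForm e d x ^ 2) 1 -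
      8 * thetaCoeff L 1 / (n * (n + 2)) * T : ℝ) * cuspSum f α +
        ((2 * T / (n * (n + 2)) : ℝ) : ℂ) * N4 := by
    rw [hq]
    ring
  push_cast at hW ⊢
  rw [hW]
  field_simp
  ring

end HessianFormula

end GaussianCore

end

noncomputable section

namespace GaussianCore

/-! ### Quadratic forms and the trace inner product -/

section QuadVal

variable {n : ℕ}

theorem quadVal_add (G H : Matrix (Fin n) (Fin n) ℝ) (x : E n) :
    quadVal (G + H) x = quadVal G x + quadVal H x := by
  rw [quadVal, quadVal, quadVal, Matrix.add_mulVec, dotProduct_add]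

theorem quadVal_smul_one (c : ℝ) (x : E n) :
    quadVal (c • (1 : Matrix (Fin n) (Fin n) ℝ)) x = c * inner ℝ x x := by
  rw [quadVal, Matrix.smul_mulVec, Matrix.one_mulVec, dotProduct_smul, smul_eq_mul]
  rfl

theorem quadVal_eq_sum (H : Matrix (Fin n) (Fin n) ℝ) (x : E n) :
    quadVal H x = ∑ p : Fin n × Fin n, x p.1 * x p.2 * H p.1 p.2 := by
  rw [Fintype.sum_prod_type]
  simp only [quadVal, dotProduct, Matrix.mulVec, Finset.mul_sum]
  exact Finset.sum_congr rfl fun i _ => Finset.sum_congr rfl fun j _ => by ring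

theorem trace_mul_eq_sum {G H : Matrix (Fin n) (Fin n) ℝ} (hH : H.IsSymm) :
    (G * H).trace = ∑ p : Fin n × Fin n, G p.1 p.2 * H p.1 p.2 := by
  rw [Fintype.sum_prod_type]
  simp only [Matrix.trace, Matrix.diag, Matrix.mul_apply]
  exact Finset.sum_congr rfl fun i _ => Finset.sum_congr rfl fun j _ => by rw [hH.apply]

theorem trace_mul_self_pos {H : Matrix (Fin n) (Fin n) ℝ} (hH : H.IsSymm) (h0 : H ≠ 0) :
    0 < (H * H).trace := by
  rw [trace_mul_eq_sum hH]
  obtain ⟨i, j, hij⟩ : ∃ i j, H i j ≠ 0 := by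
    by_contra! h
    exact h0 (Matrix.ext h)
  exact Finset.sum_pos' (fun p _ => mul_self_nonneg _)
    ⟨(i, j), Finset.mem_univ _, mul_self_pos.2 hij⟩

theorem IsTangent.add {G H : Matrix (Fin n) (Fin n) ℝ} (hG : IsTangent G) (hH : IsTangent H) :
    IsTangent (G + H) :=
  ⟨hG.1.add hH.1, by rw [Matrix.trace_add, hG.2, hH.2, add_zero]⟩

theorem trace_add_mul_add (G H : Matrix (Fin n) (Fin n) ℝ) :
    ((G + H) * (G + H)).trace = (G * G).trace + 2 * (G * H).trace + (H * H).trace := by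
  rw [add_mul, mul_add, mul_add, Matrix.trace_add, Matrix.trace_add, Matrix.trace_add,
    Matrix.trace_mul_comm H G]
  ring

end QuadVal

/-! ### Eigenvectors of the root form on the tangent space -/

section RootForm

variable {n : ℕ} {L : Submodule ℤ (E n)} [DiscreteTopology L]

theorem rootBilin_eq_sum (L : Submodule ℤ (E n)) [DiscreteTopology L]
    (G H : Matrix (Fin n) (Fin n) ℝ) :
    rootBilin L G H = ∑ x ∈ (shell_finite L 2).toFinset, quadVal G x * quadVal H x :=
  finsum_mem_eq_finite_toFinset_sum _ _

theorem rootBilin_add_right (G H K : Matrix (Fin n) (Fin n) ℝ) :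
    rootBilin L G (H + K) = rootBilin L G H + rootBilin L G K := by
  simp only [rootBilin_eq_sum, quadVal_add, mul_add, Finset.sum_add_distrib]

theorem rootBilin_add_add (G H : Matrix (Fin n) (Fin n) ℝ) :
    rootBilin L (G + H) (G + H) = rootBilin L G G + 2 * rootBilin L G H + rootBilin L H H := by
  simp only [rootBilin_eq_sum, quadVal_add, Finset.mul_sum, ← Finset.sum_add_distrib]
  exact Finset.sum_congr rfl fun x _ => by ring

/-- On $L(2)$ the form of a scalar matrix is constant, so the pairing is a multiple of a vanishing
shell sum. -/
theorem QuadraticDesign.rootBilin_smul_one (hD : QuadraticDesign L)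
    {H : Matrix (Fin n) (Fin n) ℝ} (hH : IsTangent H) (c : ℝ) :
    rootBilin L H (c • (1 : Matrix (Fin n) (Fin n) ℝ)) = 0 := by
  have hH' := isHermitian_of_isSymm hH.1
  have h1 := hD hH'.eigenvectorBasis hH'.eigenvalues (by rw [← trace_eq_sum, hH.2]) 1
  rw [shellSum, Nat.cast_one, mul_one,
    finsum_mem_eq_finite_toFinset_sum _ (shell_finite L 2)] at h1
  rw [rootBilin_eq_sum, ← mul_zero (c * 2), ← h1, Finset.mul_sum]
  refine Finset.sum_congr rfl fun x hx => ?_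
  rw [Set.Finite.mem_toFinset] at hx
  rw [quadVal_smul_one, hx.2, quadVal_eq_realDiagForm hH']
  ring

/-- Testing against trace-zero matrices is enough: a symmetric matrix splits into a trace-zero and a
scalar part, and both sides vanish on the latter. -/
theorem QuadraticDesign.isRootEigenvalue (hD : QuadraticDesign L) (hn0 : n ≠ 0)
    {H : Matrix (Fin n) (Fin n) ℝ} (hH : IsTangent H) (h0 : H ≠ 0) {lam : ℝ}
    (h : ∀ G, IsTangent G → rootBilin L H G = lam * (H * G).trace) : IsRootEigenvalue L lam := by
  refine ⟨H, hH, h0, fun G hG => ?_⟩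
  have hnR : (n : ℝ) ≠ 0 := Nat.cast_ne_zero.2 hn0
  set S : Matrix (Fin n) (Fin n) ℝ := (G.trace / n) • 1 with hS
  have hT : IsTangent (G - S) := by
    refine ⟨hG.sub (Matrix.isSymm_one.smul _), ?_⟩
    rw [Matrix.trace_sub, hS, Matrix.trace_smul, Matrix.trace_one, Fintype.card_fin, smul_eq_mul,
      div_mul_cancel₀ _ hnR, sub_self]
  have hHS : (H * S).trace = 0 := by
    rw [hS, Matrix.mul_smul, mul_one, Matrix.trace_smul, hH.2, smul_zero]
  rw [← sub_add_cancel G S, rootBilin_add_right, h _ hT, hD.rootBilin_smul_one hH, mul_add,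
    Matrix.trace_add, hHS, add_zero, add_zero]

/-- The form `∑ ξ, ⟪ξ, v⟫ ⟪ξ, w⟫` of a finite family of vectors has an eigenvector. -/
theorem exists_eigenvector_sum_inner {F ι : Type*} [NormedAddCommGroup F] [InnerProductSpace ℝ F]
    [FiniteDimensional ℝ F] [Nontrivial F] (s : Finset ι) (ξ : ι → F) :
    ∃ v : F, v ≠ 0 ∧ ∃ lam : ℝ, ∀ w : F,
      ∑ i ∈ s, inner ℝ (ξ i) v * inner ℝ (ξ i) w = lam * inner ℝ v w := by
  set T : F →ₗ[ℝ] F := ∑ i ∈ s, (innerₛₗ ℝ (ξ i)).smulRight (ξ i) with hT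
  have hTv : ∀ v w, inner ℝ (T v) w = ∑ i ∈ s, inner ℝ (ξ i) v * inner ℝ (ξ i) w := fun v w => by
    simp [hT, LinearMap.sum_apply, sum_inner, real_inner_smul_left]
  have hs : T.IsSymmetric := fun v w => by
    rw [hTv, real_inner_comm, hTv]
    exact Finset.sum_congr rfl fun i _ => mul_comm _ _
  obtain ⟨lam, hlam⟩ : ∃ lam : ℝ, Module.End.HasEigenvalue T lam :=
    ⟨_, hs.hasEigenvalue_iSup_of_finiteDimensional⟩
  obtain ⟨v, hv⟩ := hlam.exists_hasEigenvector
  refine ⟨v, hv.2, lam, fun w => ?_⟩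
  rw [← hTv, hv.apply_eq_smul, real_inner_smul_left]

/-- Needed when the coefficient of the root form in the Hessian vanishes: the Hessian is then scalar
and does not single out a `lam`. -/
theorem QuadraticDesign.exists_isRootEigenvalue (hD : QuadraticDesign L) (hn0 : n ≠ 0)
    {H : Matrix (Fin n) (Fin n) ℝ} (hH : IsTangent H) (h0 : H ≠ 0) :
    ∃ lam, IsRootEigenvalue L lam := by
  let F := EuclideanSpace ℝ (Fin n × Fin n)
  let mat : F →ₗ[ℝ] Matrix (Fin n) (Fin n) ℝ :=
    { toFun := fun v => Matrix.of fun i j => v (i, j)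
      map_add' := fun v w => rfl
      map_smul' := fun c v => rfl }
  let vec : Matrix (Fin n) (Fin n) ℝ → F := fun M => WithLp.toLp 2 fun p => M p.1 p.2
  let S : Submodule ℝ F :=
    { carrier := {v | IsTangent (mat v)}
      add_mem' := fun {v w} hv hw => by
        rw [Set.mem_ofPred_eq, map_add]
        exact hv.add hw
      zero_mem' := by
        rw [Set.mem_ofPred_eq, map_zero]
        exact ⟨Matrix.isSymm_zero, Matrix.trace_zero _ _⟩
      smul_mem' := fun c v hv => by
        rw [Set.mem_ofPred_eq, map_smul]
        exact ⟨hv.1.smul c, by rw [Matrix.trace_smul, hv.2, smul_zero]⟩ }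
  have hvec : ∀ G : Matrix (Fin n) (Fin n) ℝ, IsTangent G → vec G ∈ S := fun G hG => hG
  have hmat : ∀ v : F, mat v = 0 → v = 0 := fun v hv => by
    ext p
    exact congrFun (congrFun hv p.1) p.2
  have : Nontrivial S := ⟨⟨⟨vec H, hvec H hH⟩, 0, fun h => h0 (congrArg (fun v : S => mat v) h)⟩⟩
  -- The rank-one matrix $xx^{\mathsf T}$ projected to the tangent space; pairing with it evaluates
  -- $H[x]$.
  let ξ : E n → S := fun x => S.orthogonalProjectionOnto (WithLp.toLp 2 fun p => x p.1 * x p.2)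
  have hξ : ∀ x (v : S), inner ℝ (ξ x) v = quadVal (mat v) x := fun x v => by
    rw [Submodule.inner_orthogonalProjectionOnto_eq_of_mem_right, quadVal_eq_sum, PiLp.inner_apply]
    exact Finset.sum_congr rfl fun p _ => mul_comm _ _
  obtain ⟨v, hv0, lam, hv⟩ := exists_eigenvector_sum_inner (shell_finite L 2).toFinset ξ
  refine ⟨lam, hD.isRootEigenvalue hn0 (H := mat v) v.2
    (fun h => hv0 (Subtype.ext (hmat _ h))) fun G hG => ?_⟩
  have h1 := hv ⟨vec G, hvec G hG⟩
  simp only [hξ] at h1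
  rw [rootBilin_eq_sum, trace_mul_eq_sum hG.1]
  refine h1.trans (congrArg (lam * ·) ?_)
  rw [Submodule.coe_inner, PiLp.inner_apply]
  exact Finset.sum_congr rfl fun p _ => mul_comm _ _

end RootForm

/-! ### Comparison of the eigenvalues -/

section Eigenvalues

open Complex

variable {n : ℕ} {L : Submodule ℤ (E n)} [DiscreteTopology L] [IsZLattice ℝ L]
  {G H : Matrix (Fin n) (Fin n) ℝ}

theorem hessianBilin_formula (hL : IsEvenUnimodular L) (hD : QuadraticDesign L)
    (hn0 : n ≠ 0) (hn : n ≤ 32) (f : CuspForm 𝒮ℒ ((n : ℤ) / 2 + 4))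
    (hf : 8 < n → cuspCoeff f 1 = 1) {α : ℝ} (hα : 0 < α) (hG : IsTangent G) (hH : IsTangent H) :
    (hessianBilin α L G H : ℂ) = α ^ 2 / 2 * cuspSum f α *
        (rootBilin L G H - 8 * thetaCoeff L 1 / (n * (n + 2)) * (G * H).trace : ℝ) +
      (scalarPart L α * (G * H).trace : ℝ) := by
  rw [hessianBilin]
  push_cast
  rw [hessian_formula hL hD hn0 hn f hf hα (hG.add hH), hessian_formula hL hD hn0 hn f hf hα hG,
    hessian_formula hL hD hn0 hn f hf hα hH, rootBilin_add_add, trace_add_mul_add]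
  push_cast
  ring

theorem tsum_cuspTerm (L : Submodule ℤ (E n)) (hn0 : n ≠ 0) {k : ℤ} (f : CuspForm 𝒮ℒ k) {α : ℝ}
    (hα : 0 < α) (lam : ℝ) :
    1 / ((n : ℂ) * (n + 2)) * ∑' m : ℕ+, cuspTerm L (cuspCoeff f) α lam m =
      α ^ 2 / 2 * cuspSum f α * (lam - 8 * thetaCoeff L 1 / (n * (n + 2)) : ℝ) := by
  have hnC : (n : ℂ) ≠ 0 := Nat.cast_ne_zero.2 hn0
  have hnC2 : (n : ℂ) + 2 ≠ 0 := by exact_mod_cast (by omega : n + 2 ≠ 0)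
  rw [(hasSum_cuspTerm L f hα lam).tsum_eq]
  push_cast
  field_simp

theorem isHessianEigenvalue_iff (hL : IsEvenUnimodular L) (hD : QuadraticDesign L)
    (hn : n ≤ 32) (f : CuspForm 𝒮ℒ ((n : ℤ) / 2 + 4))
    (hf : 8 < n → cuspCoeff f 1 = 1) {α : ℝ} (hα : 0 < α) (μ : ℝ) :
    IsHessianEigenvalue α L μ ↔ ∃ lam : ℝ, IsRootEigenvalue L lam ∧
      (μ : ℂ) = 1 / ((n : ℂ) * (n + 2)) * ∑' m : ℕ+, cuspTerm L (cuspCoeff f) α lam m +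
        (scalarPart L α : ℂ) := by
  -- For $n=0$ there is no nonzero matrix, so neither side has eigenvalues.
  have hne : ∀ H : Matrix (Fin n) (Fin n) ℝ, H ≠ 0 → n ≠ 0 := by
    rintro H h0 rfl
    exact h0 (Subsingleton.elim _ _)
  constructor
  · rintro ⟨H, hH, h0, hμ⟩
    have hn0 := hne H h0
    have ht := (trace_mul_self_pos hH.1 h0).ne'
    have key : ∀ G, IsTangent G → (μ : ℂ) * (H * G).trace = α ^ 2 / 2 * cuspSum f α *
        (rootBilin L H G - 8 * thetaCoeff L 1 / (n * (n + 2)) * (H * G).trace : ℝ) +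
          (scalarPart L α * (H * G).trace : ℝ) := fun G hG => by
      rw [← hessianBilin_formula hL hD hn0 hn f hf hα hH hG, hμ G hG, ofReal_mul]
    have htC : ((H * H).trace : ℂ) ≠ 0 := ofReal_ne_zero.2 ht
    by_cases hA : (α : ℂ) ^ 2 / 2 * cuspSum f α = 0
    · obtain ⟨lam, hlam⟩ := hD.exists_isRootEigenvalue hn0 hH h0
      refine ⟨lam, hlam, ?_⟩
      have h1 := key H hH
      rw [hA, zero_mul, zero_add, ofReal_mul] at h1
      rw [tsum_cuspTerm L hn0 f hα, hA, zero_mul, zero_add, mul_right_cancel₀ htC h1]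
    -- Testing the eigenvector equation on `H` itself suggests its Rayleigh quotient as `lam`; the
    -- nonzero coefficient of the root form can then be cancelled for every `G`.
    · have hμ' : (μ : ℂ) = α ^ 2 / 2 * cuspSum f α *
          (rootBilin L H H / (H * H).trace - 8 * thetaCoeff L 1 / (n * (n + 2)) : ℝ) +
            scalarPart L α := by
        refine mul_right_cancel₀ htC ((key H hH).trans ?_)
        have h2 : rootBilin L H H - 8 * thetaCoeff L 1 / (n * (n + 2)) * (H * H).trace =
            (rootBilin L H H / (H * H).trace - 8 * thetaCoeff L 1 / (n * (n + 2))) *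
              (H * H).trace := by
          rw [sub_mul, div_mul_cancel₀ _ ht]
        rw [h2]
        simp only [ofReal_mul]
        ring
      refine ⟨rootBilin L H H / (H * H).trace, hD.isRootEigenvalue hn0 hH h0 fun G hG => ?_, ?_⟩
      · have h1 := key G hG
        rw [hμ'] at h1
        have h2 : (α : ℂ) ^ 2 / 2 * cuspSum f α *
            (rootBilin L H H / (H * H).trace * (H * G).trace : ℝ) =
              α ^ 2 / 2 * cuspSum f α * (rootBilin L H G : ℝ) := by
          simp only [ofReal_mul, ofReal_sub, ofReal_div, ofReal_add] at h1 ⊢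
          linear_combination h1
        exact (ofReal_injective (mul_left_cancel₀ hA h2)).symm
      · rw [tsum_cuspTerm L hn0 f hα, hμ']
  · rintro ⟨lam, ⟨H, hH, h0, hlam⟩, hμ⟩
    have hn0 := hne H h0
    refine ⟨H, hH, h0, fun G hG => ofReal_injective ?_⟩
    rw [hessianBilin_formula hL hD hn0 hn f hf hα hH hG, hlam G hG.1, ofReal_mul μ, hμ,
      tsum_cuspTerm L hn0 f hα]
    push_cast
    ring

end Eigenvalues

end GaussianCore

theorem theorem3p1 (n : ℕ) (hn : n ≤ 32)
    (L : Submodule ℤ (GaussianCore.E n)) [DiscreteTopology L] [IsZLattice ℝ L]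
    (hL : GaussianCore.IsEvenUnimodular L)
    (h32 : n = 32 → GaussianCore.AllShellsDesigns 2 L)
    (f : CuspForm 𝒮ℒ ((n : ℤ) / 2 + 4))
    (hf : 8 < n → GaussianCore.cuspCoeff f 1 = 1)
    (α : ℝ) (hα : 0 < α) :
    (∀ H : Matrix (Fin n) (Fin n) ℝ, GaussianCore.IsTangent H →
      (Summable fun x : {x : GaussianCore.E n // x ∈ GaussianCore.deform L H ∧ x ≠ 0} =>
        GaussianCore.gaussian α (‖(x : GaussianCore.E n)‖ ^ 2)) ∧
      ContDiffAt ℝ 2 (fun t : ℝ => GaussianCore.energy (GaussianCore.gaussian α)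
        (GaussianCore.deform L (t • H))) 0) ∧
    (∀ lam : ℝ, Summable fun m : ℕ+ =>
      GaussianCore.cuspTerm L (GaussianCore.cuspCoeff f) α lam m) ∧
    (Summable fun m : ℕ+ => GaussianCore.thetaTerm L α m) ∧
    ∀ μ : ℝ, GaussianCore.IsHessianEigenvalue α L μ ↔
      ∃ lam : ℝ, GaussianCore.IsRootEigenvalue L lam ∧
        (μ : ℂ) =
          1 / ((n : ℂ) * (n + 2)) *
              ∑' m : ℕ+, GaussianCore.cuspTerm L (GaussianCore.cuspCoeff f) α lam m +
            ((1 / ((n : ℝ) * (n + 2)) * ∑' m : ℕ+, GaussianCore.thetaTerm L α m : ℝ) : ℂ) := by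
  refine ⟨fun H hH => ?_, fun lam => (GaussianCore.hasSum_cuspTerm L f hα lam).summable,
    (hL.hasSum_thetaTerm hα).summable,
    GaussianCore.isHessianEigenvalue_iff hL (hL.quadraticDesign hn h32) hn f hf hα⟩
  have hH' := GaussianCore.isHermitian_of_isSymm hH.1
  have hs := GaussianCore.summable_gaussian_deform L hH' hα 1
  rw [one_smul] at hs
  exact ⟨hs, GaussianCore.contDiffAt_energy L hH' hα⟩

end
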